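/- Let $N\ge 1$, let $\Omega\subset\mathbb{R}^N$ be a bounded open set, and let $\omega\subset\mathbb{R}^N$ be a bounded open set whose boundary has Lebesgue measure zero (for example, a bounded open set with Lipschitz boundary). Let $0<\alpha<\beta$ and let $A_\omega$ be a measurable field of symmetric real $N\times N$ matrices on $\omega$ with $A_\omega(y)\xi\cdot\xi\ge\alpha|\xi|^2$ and $|A_\omega(y)\xi|\le\beta|\xi|$ for all $\xi\in\mathbb{R}^N$ and a.e. $y\in\omega$. Let $M=(m_{kl})$ be a constant positive definite real $N\times N$ matrix, and suppose that $A_\omega$ is equivalent to $M$, that is: after extending $A_\omega$ by $A_\omega(y)=M$ for $y\in\mathbb{R}^N\smallsetminus\omega$, for each $\lambda\in\mathbb{R}^N$ there is $w_\lambda\in H^1_{loc}(\mathbb{R}^N)$ with $$-\operatorname{div}(A_\omega\nabla w_\lambda)=0\ \text{ in }\mathbb{R}^N,\qquad w_\lambda(y)=\lambda\cdot y\ \text{ for a.e. }y\in\mathbb{R}^N\smallsetminus\omega .$$ For each $n\in\mathbb{N}$ let $(\varepsilon_{p,n})_{p\in K_n}\subset(0,\infty)$ and $(y^{p,n})_{p\in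 K_n}\subset\mathbb{R}^N$ be finite or countable families such that the sets $\varepsilon_{p,n}\omega+y^{p,n}$, $p\in K_n$, are pairwise disjoint, $$\operatorname{meas}\Big(\Omega\smallsetminus\bigcup_{p\in K_n}(\varepsilon_{p,n}\omega+y^{p,n})\Big)=0,\qquad\text{and}\qquad \sup_{p\in K_n}\varepsilon_{p,n}\to0\ \text{ as } n\to\infty .$$ Define, for a.e. $x\in\Omega$, $$A^n_\omega(x)=A_\omega\Big(\frac{x-y^{p,n}}{\varepsilon_{p,n}}\Big)\quad\text{if }x\in\varepsilon_{p,n}\omega+y^{p,n},\ p\in K_n .$$ Let $f\in L^2(\Omega)$. Then for each $n$ the problem $-\operatorname{div}(A^n_\omega\nabla u^n)=f$ in $\Omega$ has a unique weak solution $u^n\in H^1_0(\Omega)$, and there is $u\in H^1_0(\Omega)$ such that, for the entire sequence, $$u^n\rightharpoonup u\ \text{ weakly in }H^1_0(\Omega),\qquad A^n_\omega\nabla u^n\rightharpoonup M\nabla u\ \text{ weakly in }L^2(\Omega)^N .$$ In particular, $u$ is a weak solution of the homogenized equation $-\operatorname{div}(M\nabla u)=f$ in $\Omega$. -/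

import Mathlib

open MeasureTheory Filter Topology Set
open scoped ENNReal

/-- The space `ℝ^N` with its Euclidean norm. -/
abbrev RN (N : ℕ) : Type := EuclideanSpace ℝ (Fin N)

/-- Real `N × N` matrices. -/
abbrev Mat (N : ℕ) : Type := Matrix (Fin N) (Fin N) ℝ

/-- Lebesgue measure on `Ω ⊆ ℝ^N`. -/
noncomputable abbrev vol {N : ℕ} (Ω : Set (RN N)) : Measure (RN N) := volume.restrict Ω

/-- `φ ∈ D(Ω)`: smooth real functions with compact support contained in `Ω`. -/
structure IsTest {N : ℕ} (Ω : Set (RN N)) (φ : RN N → ℝ) : Prop where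
  smooth : ContDiff ℝ (⊤ : ℕ∞) φ
  compact : HasCompactSupport φ
  subset : tsupport φ ⊆ Ω

/-! ### The space `H^1_0(Ω)` -/

/-- `L²(Ω) × L²(Ω)^N` with the Hilbert norm `(‖u‖² + ‖G‖²)^{1/2}`. A function of `H^1(Ω)` is
represented in it by the pair `(u, ∇u)`, so that this norm is its `H^1` norm. -/
abbrev GraphSpace {N : ℕ} (Ω : Set (RN N)) : Type :=
  WithLp 2 (Lp ℝ 2 (vol Ω) × Lp (RN N) 2 (vol Ω))

theorem IsTest.zero {N : ℕ} (Ω : Set (RN N)) : IsTest Ω (0 : RN N → ℝ) where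
  smooth := contDiff_const
  compact := HasCompactSupport.zero
  subset := by simp [tsupport]

theorem IsTest.add {N : ℕ} {Ω : Set (RN N)} {φ ψ : RN N → ℝ} (hφ : IsTest Ω φ)
    (hψ : IsTest Ω ψ) : IsTest Ω (φ + ψ) where
  smooth := hφ.smooth.add hψ.smooth
  compact := hφ.compact.add hψ.compact
  subset := (tsupport_add φ ψ).trans (union_subset hφ.subset hψ.subset)

theorem IsTest.smul {N : ℕ} {Ω : Set (RN N)} {φ : RN N → ℝ} (c : ℝ) (hφ : IsTest Ω φ) :
    IsTest Ω (c • φ) where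
  smooth := contDiff_const.smul hφ.smooth
  compact := hφ.compact.smul_left
  subset := (tsupport_smul_subset_right (fun _ => c) φ).trans hφ.subset

theorem IsTest.differentiableAt {N : ℕ} {Ω : Set (RN N)} {φ : RN N → ℝ} (hφ : IsTest Ω φ)
    (x : RN N) : DifferentiableAt ℝ φ x :=
  (hφ.smooth.differentiable (by simp)).differentiableAt

/-- The test functions inside `GraphSpace Ω`: the classes of the pairs `(φ, ∇φ)`, `φ ∈ D(Ω)`. -/
noncomputable def testPairs {N : ℕ} (Ω : Set (RN N)) : Submodule ℝ (GraphSpace Ω) where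
  carrier := {v | ∃ φ : RN N → ℝ, IsTest Ω φ ∧ v.fst =ᵐ[vol Ω] φ ∧ v.snd =ᵐ[vol Ω] gradient φ}
  zero_mem' := by
    refine ⟨0, IsTest.zero Ω, Lp.coeFn_zero _ _ _, ?_⟩
    filter_upwards [Lp.coeFn_zero (RN N) 2 (vol Ω)] with x hx
    have h : gradient (0 : RN N → ℝ) x = 0 := by simp [gradient]
    rw [h]
    exact hx
  add_mem' := by
    rintro v w ⟨φ, hφ, h1, h2⟩ ⟨ψ, hψ, h3, h4⟩
    refine ⟨φ + ψ, hφ.add hψ, ?_, ?_⟩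
    · filter_upwards [Lp.coeFn_add v.fst w.fst, h1, h3] with x hx a b
      rw [WithLp.add_fst, hx, Pi.add_apply, Pi.add_apply, a, b]
    · filter_upwards [Lp.coeFn_add v.snd w.snd, h2, h4] with x hx a b
      rw [WithLp.add_snd, hx, Pi.add_apply, a, b]
      simp only [gradient]
      rw [fderiv_add (hφ.differentiableAt x) (hψ.differentiableAt x), map_add]
  smul_mem' := by
    rintro c v ⟨φ, hφ, h1, h2⟩
    refine ⟨c • φ, hφ.smul c, ?_, ?_⟩
    · filter_upwards [Lp.coeFn_smul c v.fst, h1] with x hx a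
      rw [WithLp.smul_fst, hx, Pi.smul_apply, Pi.smul_apply, a]
    · filter_upwards [Lp.coeFn_smul c v.snd, h2] with x hx a
      rw [WithLp.smul_snd, hx, Pi.smul_apply, a]
      simp only [gradient]
      rw [fderiv_const_smul (hφ.differentiableAt x)]
      simp

/-- `H^1_0(Ω)`: the closure of `D(Ω)` in the `H^1` norm. -/
noncomputable def H10 {N : ℕ} (Ω : Set (RN N)) : Submodule ℝ (GraphSpace Ω) :=
  (testPairs Ω).topologicalClosure

/-- The function (an element of `L²(Ω)`) underlying `u ∈ H^1_0(Ω)`. -/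
noncomputable def H10.fn {N : ℕ} {Ω : Set (RN N)} (u : H10 Ω) : Lp ℝ 2 (vol Ω) :=
  (u : GraphSpace Ω).fst

/-- The gradient (an element of `L²(Ω)^N`) of `u ∈ H^1_0(Ω)`. -/
noncomputable def H10.grad {N : ℕ} {Ω : Set (RN N)} (u : H10 Ω) : Lp (RN N) 2 (vol Ω) :=
  (u : GraphSpace Ω).snd

/-- Weak convergence `x_n ⇀ l` in a real normed space. -/
def WeakTendsto {E : Type*} [NormedAddCommGroup E] [NormedSpace ℝ E] (x : ℕ → E) (l : E) : Prop :=
  Tendsto (fun n => toWeakSpace ℝ E (x n)) atTop (𝓝 (toWeakSpace ℝ E l))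

/-! ### Coefficients and the Dirichlet problem -/

/-- The field `x ↦ A(x) G(x)`. -/
noncomputable def flux {N : ℕ} (A : RN N → Mat N) (G : RN N → RN N) : RN N → RN N :=
  fun x => Matrix.toEuclideanLin (A x) (G x)

/-- The class `𝓜(α, β; Ω)` of measurable symmetric matrix fields with
`A(x)ξ·ξ ≥ α|ξ|²` and `|A(x)ξ| ≤ β|ξ|` for all `ξ` and a.e. `x ∈ Ω`. -/
structure IsCoeff {N : ℕ} (α β : ℝ) (Ω : Set (RN N)) (A : RN N → Mat N) : Prop where
  aemeasurable : ∀ i j, AEMeasurable (fun x => A x i j) (vol Ω)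
  symm : ∀ᵐ x ∂(vol Ω), ∀ i j, A x i j = A x j i
  coercive : ∀ᵐ x ∂(vol Ω), ∀ ξ : RN N,
    α * ‖ξ‖ ^ 2 ≤ inner ℝ (Matrix.toEuclideanLin (A x) ξ) ξ
  bounded : ∀ᵐ x ∂(vol Ω), ∀ ξ : RN N, ‖Matrix.toEuclideanLin (A x) ξ‖ ≤ β * ‖ξ‖

/-- `u ∈ H^1_0(Ω)` is a (weak) solution of `-div(A∇u) = f` in `Ω`. -/
def IsDirichletSolution {N : ℕ} {Ω : Set (RN N)} (A : RN N → Mat N) (f : Lp ℝ 2 (vol Ω))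
    (u : H10 Ω) : Prop :=
  ∀ v : H10 Ω, ∫ x in Ω, inner ℝ (flux A (H10.grad u) x) (H10.grad v x) = ∫ x in Ω, f x * H10.fn v x

/-! ### Hashin–Shtrikman microstructures -/

/-- `w ∈ H^1_loc(ℝ^N)` with weak gradient `G`. -/
structure IsH1Loc {N : ℕ} (w : RN N → ℝ) (G : RN N → RN N) : Prop where
  memLp : ∀ C : Set (RN N), IsCompact C → MemLp w 2 (vol C)
  memLp_grad : ∀ C : Set (RN N), IsCompact C → MemLp G 2 (vol C)
  weak_grad : ∀ φ : RN N → ℝ, IsTest univ φ → ∫ x, w x • gradient φ x = - ∫ x, φ x • G x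

open Classical in
/-- The extension of `A` from `ω` to `ℝ^N` by the constant matrix `M`. -/
noncomputable def extendBy {N : ℕ} (ω : Set (RN N)) (A : RN N → Mat N) (M : Mat N) :
    RN N → Mat N :=
  fun y => if y ∈ ω then A y else M

/-- `A` (given on `ω`) is equivalent to `M`: for each `l ∈ ℝ^N` there is `w ∈ H^1_loc(ℝ^N)` with
`-div(A∇w) = 0` in `ℝ^N`, where `A` is extended by `M`, and `w(y) = l·y` in `ℝ^N ∖ ω`. -/
def IsEquivalentTo {N : ℕ} (ω : Set (RN N)) (A : RN N → Mat N) (M : Mat N) : Prop :=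
  ∀ l : RN N, ∃ (w : RN N → ℝ) (G : RN N → RN N), IsH1Loc w G ∧
    (∀ φ : RN N → ℝ, IsTest univ φ →
      ∫ y, inner ℝ (flux (extendBy ω A M) G y) (gradient φ y) = 0) ∧
    ∀ᵐ y ∂(vol ωᶜ), w y = inner ℝ l y

/-- The rescaled copy `εω + y`. -/
def cell {N : ℕ} (ω : Set (RN N)) (ε : ℝ) (y : RN N) : Set (RN N) :=
  (fun z => ε • z + y) '' ω

/-- For each `n`, the copies `ε_{p,n} ω + y^{p,n}` (`p ∈ K n`, `K n` finite or countable) are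
disjoint and cover `Ω` up to a null set, and `sup_p ε_{p,n} → 0`. The supremum is taken in `[0, ∞]`. -/
structure IsVitaliCovering {N : ℕ} (Ω ω : Set (RN N)) {K : ℕ → Type*} (ε : ∀ n, K n → ℝ)
    (y : ∀ n, K n → RN N) : Prop where
  countable : ∀ n, Countable (K n)
  pos : ∀ n p, 0 < ε n p
  disjoint : ∀ n p q, p ≠ q → Disjoint (cell ω (ε n p) (y n p)) (cell ω (ε n q) (y n q))
  covers : ∀ n, volume (Ω \ ⋃ p, cell ω (ε n p) (y n p)) = 0
  scales : Tendsto (fun n => ⨆ p, ENNReal.ofReal (ε n p)) atTop (𝓝 0)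

open Classical in
/-- The Hashin–Shtrikman coefficients: `A((x - y_p)/ε_p)` for `x` in the copy `ε_p ω + y_p`
(which is unique when the copies are disjoint), and `0` off all copies. -/
noncomputable def hsCoeff {N : ℕ} (ω : Set (RN N)) (A : RN N → Mat N) {K : Type*} (ε : K → ℝ)
    (y : K → RN N) : RN N → Mat N :=
  fun x => if h : ∃ p, x ∈ cell ω (ε p) (y p) then
    A ((ε h.choose)⁻¹ • (x - y h.choose)) else 0

/-! The proof is Tartar's method of oscillating test functions, made quantitative so that no
compactness and no subsequence is needed. From the function `w` attached to `l` put `r = w - l·y`,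
`R = ∇r` and `g = A(l + R) - Ml`, extended by zero outside `ω`. Since `w` is linear outside `ω` and
the frontier is null, `r`, `R` and `g` all vanish a.e. off `ω`, and `g` is divergence free on the
whole space (`IsEquivalentTo.exists_isCorrector`). On a cell of size `ε` the rescaled corrector is
`ε r((x - y)/ε)`, while `R` and `g` are only composed with the rescaling.

By symmetry of `A`, on each cell `A∇u·l - Ml·∇u = g·∇u - A∇u·R`. Multiply by a test function `φ` and
integrate (`IsCorrector.setIntegral_eq`). As `g` is orthogonal to gradients, `φ` may be replaced by
`φ - t` in the first term, and `φ` oscillates by `O(ε)` on the cell. The equation tested with `φ r`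
turns the second term into integrals that contain the small factor `r` itself. So a cell contributes
`O(ε)` times an integrable quantity, and disjointness of the cells lets these be summed
(`abs_integral_le_of_covering`). Hence `d_n = A^n∇u^n - M∇u^n` tends to `0` in the sense of
distributions, and, being bounded in `L²`, also weakly there.

To conclude (`weakTendsto_of_flux_sub_tendsto`), take for `u` the solution of the problem with
matrix `M`. Then `∫ M∇u^n·∇v = ∫ f v - ∫ d_n·∇v` tends to `∫ M∇u·∇v` for all `v`; by Lax–Milgram for
`M` every functional on `H^1_0` is of this form, so the entire sequence converges weakly, and the
fluxes are `d_n + M∇u^n`. Symmetry of `M` is not assumed but follows from that of `A`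
(`IsCorrector.inner_comm`). -/

/-! ### Weak convergence in Hilbert spaces. -/

/-- In a Hilbert space, weak convergence may be tested against inner products. -/
theorem weakTendsto_of_inner {H : Type*} [NormedAddCommGroup H] [InnerProductSpace ℝ H]
    [CompleteSpace H] {x : ℕ → H} {l : H}
    (h : ∀ z : H, Tendsto (fun n => inner ℝ z (x n)) atTop (𝓝 (inner ℝ z l))) :
    WeakTendsto x l := by
  refine (WeakBilin.tendsto_iff_forall_eval_tendsto _ ?_).2 fun T => ?_
  · intro a b hab
    by_contra hne
    obtain ⟨T, hT⟩ := SeparatingDual.exists_separating_of_ne (R := ℝ) hne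
    exact hT (LinearMap.congr_fun hab T)
  · have := h ((InnerProductSpace.toDual ℝ H).symm T)
    simp only [InnerProductSpace.toDual_symm_apply] at this
    exact this

/-- A bounded sequence whose inner products with a total set tend to `0` converges weakly to `0`. -/
theorem tendsto_inner_zero_of_total {H : Type*} [NormedAddCommGroup H] [InnerProductSpace ℝ H]
    [CompleteSpace H] {x : ℕ → H} {C : ℝ} (hC : ∀ n, ‖x n‖ ≤ C) (S : Set H)
    (hS : ∀ z : H, (∀ s ∈ S, inner ℝ s z = 0) → z = 0)
    (h : ∀ s ∈ S, Tendsto (fun n => inner ℝ s (x n)) atTop (𝓝 0)) (z : H) :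
    Tendsto (fun n => inner ℝ z (x n)) atTop (𝓝 0) := by
  have hC0 : 0 ≤ C := (norm_nonneg _).trans (hC 0)
  let V : Submodule ℝ H :=
    { carrier := {z | Tendsto (fun n => inner ℝ z (x n)) atTop (𝓝 0)}
      zero_mem' := by simp
      add_mem' := fun {a b} ha hb => by
        have := Tendsto.add (show Tendsto _ _ _ from ha) (show Tendsto _ _ _ from hb)
        simpa [inner_add_left] using this
      smul_mem' := fun c a ha => by
        have := Tendsto.const_mul c (show Tendsto _ _ _ from ha)
        simpa [inner_smul_left] using this }
  have hVc : IsClosed (V : Set H) := by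
    refine isClosed_of_closure_subset fun a ha => ?_
    change Tendsto (fun n => inner ℝ a (x n)) atTop (𝓝 0)
    rw [Metric.tendsto_atTop]
    intro e he
    -- The bound on `x n` makes this approximation uniform in `n`; `C + 1` keeps the denominator
    -- positive.
    obtain ⟨b, hb, hab⟩ := Metric.mem_closure_iff.1 ha (e / (2 * (C + 1))) (by positivity)
    obtain ⟨n₀, hn₀⟩ := Metric.tendsto_atTop.1 (show Tendsto (fun n => inner ℝ b (x n)) atTop (𝓝 0)
      from hb) (e / 2) (by positivity)
    refine ⟨n₀, fun n hn => ?_⟩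
    have h1 := hn₀ n hn
    rw [dist_zero_right, Real.norm_eq_abs] at h1 ⊢
    have h2 : |inner ℝ (a - b) (x n)| ≤ e / 2 := by
      refine (abs_real_inner_le_norm _ _).trans ?_
      rw [dist_eq_norm] at hab
      calc ‖a - b‖ * ‖x n‖ ≤ (e / (2 * (C + 1))) * (C + 1) := by
            have := hC n
            gcongr
            linarith
        _ = e / 2 := by field_simp
    have h3 : inner ℝ a (x n) = inner ℝ (a - b) (x n) + inner ℝ b (x n) := by
      rw [← inner_add_left]; simp
    rw [h3]
    calc _ ≤ _ := abs_add_le _ _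
      _ < e := by linarith
  -- A closed subspace with trivial orthogonal complement is the whole space.
  have hVt : V = ⊤ := by
    have := hVc.completeSpace_coe
    rw [← Submodule.orthogonal_eq_bot_iff, Submodule.eq_bot_iff]
    intro y hy
    exact hS y fun s hs => hy s (h s hs)
  have : z ∈ V := hVt ▸ Submodule.mem_top
  exact this

/-! ### Translations and mollifiers in `L²`. -/

/-- Translations are continuous in `L²`. -/
theorem tendsto_eLpNorm_translate_sub {N : ℕ} {F : Type*} [NormedAddCommGroup F]
    {v : RN N → F} (hv : MemLp v 2 volume) :
    Tendsto (fun z : RN N => eLpNorm (fun x => v (x - z) - v x) 2 volume) (𝓝 0) (𝓝 0) := by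
  -- The translations form a continuous family for the compact-open topology, and composition with
  -- measure preserving maps depends continuously on the map in that topology.
  let g : RN N → C(RN N, RN N) := fun z => ⟨fun x => x - z, by fun_prop⟩
  have hg : Continuous g := ContinuousMap.continuous_of_continuous_uncurry _ (by
    simp only [g, Function.uncurry_def, ContinuousMap.coe_mk]; fun_prop)
  have hgm : ∀ z, MeasurePreserving (g z) volume volume := fun z =>
    measurePreserving_sub_right volume z
  have h := (continuous_const (y := hv.toLp v)).compMeasurePreservingLp hg hgm (by simp)
  have h0 := h.tendsto 0
  rw [tendsto_iff_edist_tendsto_0] at h0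
  refine h0.congr fun z => ?_
  rw [Lp.edist_def]
  refine eLpNorm_congr_ae ?_
  have e1 := Lp.coeFn_compMeasurePreserving (hv.toLp v) (hgm z)
  have e0 := Lp.coeFn_compMeasurePreserving (hv.toLp v) (hgm 0)
  have e2 := (hgm z).quasiMeasurePreserving.ae_eq_comp hv.coeFn_toLp
  have e3 := (hgm 0).quasiMeasurePreserving.ae_eq_comp hv.coeFn_toLp
  filter_upwards [e0, e1, e2, e3] with x a b c d
  simp only [Pi.sub_apply]
  rw [a, b, c, d]
  simp [g]

/-- Jensen's inequality for the average of `F` with weight `η`. -/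
theorem enorm_integral_smul_sq_le {N : ℕ} {F : Type*} [NormedAddCommGroup F] [NormedSpace ℝ F]
    {η : RN N → ℝ} (hη : Continuous η) (h0 : ∀ z, 0 ≤ η z) (hi : Integrable η)
    (h1 : ∫ z, η z = 1) {w : RN N → F} (hw : AEStronglyMeasurable w volume) :
    ‖∫ z, η z • w z‖ₑ ^ 2 ≤ ∫⁻ z, ENNReal.ofReal (η z) * ‖w z‖ₑ ^ 2 := by
  have hm : Measurable fun z => ENNReal.ofReal (η z) := hη.measurable.ennreal_ofReal
  -- With `η` as density this is a probability measure, for which the `L¹` norm is at most the `L²`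
  -- norm.
  let μ : Measure (RN N) := volume.withDensity fun z => ENNReal.ofReal (η z)
  have hμ : IsProbabilityMeasure μ := ⟨by
    rw [withDensity_apply _ MeasurableSet.univ, setLIntegral_univ,
      ← ofReal_integral_eq_lintegral_ofReal hi (Eventually.of_forall h0), h1, ENNReal.ofReal_one]⟩
  have hwμ : AEStronglyMeasurable w μ := hw.mono_ac (withDensity_absolutelyContinuous _ _)
  have h2 : ∫ z, η z • w z = ∫ z, w z ∂μ := by
    rw [integral_withDensity_eq_integral_toReal_smul hm (by simp)]
    simp only [ENNReal.toReal_ofReal (h0 _)]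
  have h3 : ∫⁻ z, ENNReal.ofReal (η z) * ‖w z‖ₑ ^ 2 = ∫⁻ z, ‖w z‖ₑ ^ 2 ∂μ := by
    rw [lintegral_withDensity_eq_lintegral_mul_non_measurable _ hm (by simp)]
    rfl
  have h4 : eLpNorm w 1 μ ≤ eLpNorm w 2 μ :=
    eLpNorm_le_eLpNorm_of_exponent_le (by norm_num) hwμ
  have h5 : eLpNorm w 2 μ ^ 2 = ∫⁻ z, ‖w z‖ₑ ^ 2 ∂μ := by
    have := eLpNorm_nnreal_pow_eq_lintegral (μ := μ) (f := w) (p := 2) (by norm_num)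
    simpa using this
  rw [h2, h3, ← h5]
  gcongr
  refine le_trans ?_ h4
  rw [eLpNorm_one_eq_lintegral_enorm]
  exact enorm_integral_le_lintegral_enorm _

open scoped Convolution in
/-- Mollifications converge in `L²`. -/
theorem exists_eLpNorm_mollify_sub_le {N : ℕ} {F : Type*} [NormedAddCommGroup F]
    [NormedSpace ℝ F] [CompleteSpace F] {v : RN N → F} (hv : MemLp v 2 volume) {e : ℝ≥0∞}
    (he : 0 < e) :
    ∃ δ > 0, ∀ ψ : ContDiffBump (0 : RN N), ψ.rOut ≤ δ →
      eLpNorm (fun x => (ψ.normed volume ⋆[ContinuousLinearMap.lsmul ℝ ℝ, volume] v) x - v x) 2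
        volume ≤ e := by
  have ht := (tendsto_eLpNorm_translate_sub hv).eventually (Iic_mem_nhds he)
  obtain ⟨δ, hδ, hball⟩ := Metric.eventually_nhds_iff.1 ht
  refine ⟨δ, hδ, fun ψ hψ => ?_⟩
  set η := ψ.normed (volume : Measure (RN N)) with hη
  have hηc : Continuous η := ψ.continuous_normed
  have hη0 : ∀ z, 0 ≤ η z := ψ.nonneg_normed
  have hηi : Integrable η := ψ.integrable_normed
  have hη1 : ∫ z, η z = 1 := ψ.integral_normed
  have hloc : LocallyIntegrable v volume := hv.locallyIntegrable (by norm_num)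
  have hconv : ∀ x, (η ⋆[ContinuousLinearMap.lsmul ℝ ℝ, volume] v) x - v x
      = ∫ z, η z • (v (x - z) - v x) := fun x => by
    have hex : Integrable fun z => η z • v (x - z) :=
      (ψ.hasCompactSupport_normed.convolutionExists_left (ContinuousLinearMap.lsmul ℝ ℝ)
        hηc hloc) x
    simp only [smul_sub]
    rw [integral_sub hex (hηi.smul_const _), integral_smul_const, hη1, one_smul,
      convolution_lsmul]
  have hq : AEStronglyMeasurable (fun p : RN N × RN N => v (p.1 - p.2) - v p.1)
      (volume.prod volume) :=
    (hv.1.comp_quasiMeasurePreserving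
      (quasiMeasurePreserving_sub_of_right_invariant volume volume)).sub hv.1.comp_fst
  have hsq : eLpNorm (fun x => (η ⋆[ContinuousLinearMap.lsmul ℝ ℝ, volume] v) x - v x) 2
        volume ^ 2 ≤ e ^ 2 := by
    have h5 : ∀ u : RN N → F, eLpNorm u 2 volume ^ 2 = ∫⁻ z, ‖u z‖ₑ ^ 2 := fun u => by
      have := eLpNorm_nnreal_pow_eq_lintegral (μ := (volume : Measure (RN N))) (f := u) (p := 2)
        (by norm_num)
      simpa using this
    rw [h5]
    calc ∫⁻ x, ‖(η ⋆[ContinuousLinearMap.lsmul ℝ ℝ, volume] v) x - v x‖ₑ ^ 2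
        ≤ ∫⁻ x, ∫⁻ z, ENNReal.ofReal (η z) * ‖v (x - z) - v x‖ₑ ^ 2 := by
          refine lintegral_mono fun x => ?_
          rw [hconv]
          refine enorm_integral_smul_sq_le hηc hη0 hηi hη1 ?_
          exact (hv.1.comp_measurePreserving (Measure.measurePreserving_sub_left volume x)).sub
            aestronglyMeasurable_const
      _ = ∫⁻ z, ENNReal.ofReal (η z) * ∫⁻ x, ‖v (x - z) - v x‖ₑ ^ 2 := by
          rw [lintegral_lintegral_swap]
          · refine lintegral_congr fun z => ?_
            rw [lintegral_const_mul' _ _ ENNReal.ofReal_ne_top]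
          · exact (hηc.measurable.ennreal_ofReal.comp measurable_snd).aemeasurable.mul
              (hq.enorm.pow_const 2)
      _ ≤ ∫⁻ z, ENNReal.ofReal (η z) * e ^ 2 := by
          refine lintegral_mono fun z => ?_
          by_cases hz : z ∈ Function.support η
          · rw [hη, ψ.support_normed_eq] at hz
            have h6 := hball (lt_of_lt_of_le hz hψ)
            rw [← h5]
            gcongr
          · rw [Function.notMem_support.1 hz]; simp
      _ = e ^ 2 := by
          rw [lintegral_mul_const _ hηc.measurable.ennreal_ofReal,
            ← ofReal_integral_eq_lintegral_ofReal hηi (Eventually.of_forall hη0), hη1]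
          simp
  exact (ENNReal.pow_le_pow_left_iff two_ne_zero).1 hsq

/-! ### Test functions, weak gradients and membership in `H^1_0`. -/

theorem IsTest.mono {N : ℕ} {U V : Set (RN N)} {φ : RN N → ℝ} (hφ : IsTest U φ) (h : U ⊆ V) :
    IsTest V φ := ⟨hφ.smooth, hφ.compact, hφ.subset.trans h⟩

theorem IsTest.continuous {N : ℕ} {U : Set (RN N)} {φ : RN N → ℝ} (hφ : IsTest U φ) :
    Continuous φ := hφ.smooth.continuous

theorem IsTest.continuous_gradient {N : ℕ} {U : Set (RN N)} {φ : RN N → ℝ} (hφ : IsTest U φ) :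
    Continuous (gradient φ) :=
  (InnerProductSpace.toDual ℝ (RN N)).symm.continuous.comp (hφ.smooth.continuous_fderiv (by simp))

theorem IsTest.gradient_eq_zero {N : ℕ} {U : Set (RN N)} {φ : RN N → ℝ} (hφ : IsTest U φ)
    {x : RN N} (hx : x ∉ U) : gradient φ x = 0 := by
  have : fderiv ℝ φ x = 0 := by
    by_contra h
    exact hx (hφ.subset (support_fderiv_subset ℝ h))
  simp [gradient, this]

theorem IsTest.eq_zero {N : ℕ} {U : Set (RN N)} {φ : RN N → ℝ} (hφ : IsTest U φ)
    {x : RN N} (hx : x ∉ U) : φ x = 0 := by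
  by_contra h
  exact hx (hφ.subset (subset_tsupport _ h))

theorem IsTest.hasCompactSupport_gradient {N : ℕ} {U : Set (RN N)} {φ : RN N → ℝ}
    (hφ : IsTest U φ) : HasCompactSupport (gradient φ) :=
  (hφ.compact.fderiv ℝ).comp_left (g := (InnerProductSpace.toDual ℝ (RN N)).symm) (map_zero _)

theorem IsTest.mul {N : ℕ} {U : Set (RN N)} {φ ψ : RN N → ℝ} (hφ : IsTest U φ)
    (hψ : ContDiff ℝ (⊤ : ℕ∞) ψ) : IsTest U (fun x => φ x * ψ x) where
  smooth := hφ.smooth.mul hψ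
  compact := hφ.compact.mul_right
  subset := (tsupport_mul_subset_left (f := φ) (g := ψ)).trans hφ.subset

theorem gradient_mul {N : ℕ} {φ ψ : RN N → ℝ} {x : RN N} (hφ : DifferentiableAt ℝ φ x)
    (hψ : DifferentiableAt ℝ ψ x) :
    gradient (fun x => φ x * ψ x) x = φ x • gradient ψ x + ψ x • gradient φ x := by
  simp only [gradient]
  rw [fderiv_fun_mul hφ hψ]
  simp

/-- A pair `(r, R)` of a square integrable function on `ℝ^N` and its weak gradient. -/
structure IsWeakH1 {N : ℕ} (r : RN N → ℝ) (R : RN N → RN N) : Prop where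
  memLp : MemLp r 2 volume
  memLp_grad : MemLp R 2 volume
  weak_grad : ∀ φ : RN N → ℝ, IsTest univ φ → ∫ x, r x • gradient φ x = - ∫ x, φ x • R x

theorem MeasureTheory.LocallyIntegrable.smul_test {N : ℕ} {F : Type*} [NormedAddCommGroup F]
    [NormedSpace ℝ F] {v : RN N → F} (hv : LocallyIntegrable v volume) {U : Set (RN N)}
    {φ : RN N → ℝ} (hφ : IsTest U φ) : Integrable (fun x => φ x • v x) volume :=
  hv.integrable_smul_left_of_hasCompactSupport hφ.continuous hφ.compact

theorem MeasureTheory.LocallyIntegrable.smul_gradient {N : ℕ} {v : RN N → ℝ}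
    (hv : LocallyIntegrable v volume) {U : Set (RN N)} {φ : RN N → ℝ} (hφ : IsTest U φ) :
    Integrable (fun x => v x • gradient φ x) volume :=
  hv.integrable_smul_right_of_hasCompactSupport hφ.continuous_gradient
    hφ.hasCompactSupport_gradient

theorem IsTest.memLp_top {N : ℕ} {U : Set (RN N)} {φ : RN N → ℝ} (hφ : IsTest U φ) :
    MemLp φ ⊤ volume := hφ.continuous.memLp_top_of_hasCompactSupport hφ.compact _

theorem IsTest.memLp_top_gradient {N : ℕ} {U : Set (RN N)} {φ : RN N → ℝ} (hφ : IsTest U φ) :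
    MemLp (gradient φ) ⊤ volume :=
  hφ.continuous_gradient.memLp_top_of_hasCompactSupport hφ.hasCompactSupport_gradient _

/-- The product rule for a weak gradient and a test function. -/
theorem IsWeakH1.mul_test {N : ℕ} {r : RN N → ℝ} {R : RN N → RN N} (h : IsWeakH1 r R)
    {U : Set (RN N)} {φ : RN N → ℝ} (hφ : IsTest U φ) :
    IsWeakH1 (fun x => φ x * r x) (fun x => r x • gradient φ x + φ x • R x) where
  memLp := h.memLp.mul (p := ⊤) hφ.memLp_top
  memLp_grad :=
    (hφ.memLp_top_gradient.smul (p := 2) h.memLp).add (h.memLp_grad.smul (p := ⊤) hφ.memLp_top)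
  weak_grad ψ hψ := by
    have hr := h.memLp.locallyIntegrable (by norm_num)
    have hR := h.memLp_grad.locallyIntegrable (by norm_num)
    have hφψ : IsTest U (fun x => φ x * ψ x) := hφ.mul hψ.smooth
    have hg : LocallyIntegrable (fun x => r x • gradient φ x) volume :=
      (hr.smul_gradient hφ).locallyIntegrable
    have h1 := h.weak_grad _ (hφψ.mono (subset_univ _))
    have e1 : ∀ x, (φ x * r x) • gradient ψ x
        = r x • gradient (fun x => φ x * ψ x) x - ψ x • (r x • gradient φ x) := fun x => by
      rw [gradient_mul (hφ.differentiableAt x) (hψ.differentiableAt x)]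
      module
    have e2 : ∀ x, ψ x • (r x • gradient φ x + φ x • R x)
        = ψ x • (r x • gradient φ x) + (φ x * ψ x) • R x := fun x => by module
    simp only [e1, e2]
    rw [integral_sub (hr.smul_gradient hφψ) (hg.smul_test hψ),
      integral_add (hg.smul_test hψ) (hR.smul_test hφψ), h1]
    abel

-- The gradient falls on the mollifier, and `t ↦ η(x - t)` is an admissible test function in the
-- definition of the weak gradient; its reflected argument supplies the sign.
open scoped Convolution in
theorem IsWeakH1.gradient_mollify {N : ℕ} {v : RN N → ℝ} {V : RN N → RN N} (h : IsWeakH1 v V)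
    (ψ : ContDiffBump (0 : RN N)) (x : RN N) :
    gradient (ψ.normed volume ⋆[ContinuousLinearMap.lsmul ℝ ℝ, volume] v) x
      = (ψ.normed volume ⋆[ContinuousLinearMap.lsmul ℝ ℝ, volume] V) x := by
  set η := ψ.normed (volume : Measure (RN N)) with hη
  have hηs : ContDiff ℝ (⊤ : ℕ∞) η := ψ.contDiff_normed
  have hηc : HasCompactSupport η := ψ.hasCompactSupport_normed
  have hloc := h.memLp.locallyIntegrable (by norm_num)
  have hd := hηc.hasFDerivAt_convolution_left (ContinuousLinearMap.lsmul ℝ ℝ)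
    (hηs.of_le (by simp)) hloc x
  have ht : IsTest univ (fun t => η (x - t)) :=
    ⟨hηs.comp (contDiff_const.sub contDiff_id),
      hηc.comp_homeomorph (Homeomorph.subLeft x), subset_univ _⟩
  have hg : ∀ t, gradient (fun t => η (x - t)) t = - gradient η (x - t) := fun t => by
    have : HasFDerivAt (fun t => η (x - t)) _ t :=
      ((hηs.differentiable (by simp)).differentiableAt (x := x - t)).hasFDerivAt.comp t
        ((hasFDerivAt_id t).const_sub x)
    rw [gradient, this.fderiv]
    simp [gradient]
  have hw := h.weak_grad _ ht
  have hI := (hloc.smul_gradient ht).neg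
  simp only [hg, smul_neg, integral_neg, neg_inj] at hw
  simp only [hg, smul_neg, Pi.neg_def, neg_neg] at hI
  have hex : ConvolutionExistsAt (fderiv ℝ η) v x
      ((ContinuousLinearMap.lsmul ℝ ℝ).precompL (RN N)) volume :=
    (hηc.fderiv ℝ).convolutionExists_left _ (hηs.continuous_fderiv (by simp)) hloc x
  rw [convolution_lsmul_swap, ← hw]
  refine ext_inner_right ℝ fun y => ?_
  rw [gradient, hd.fderiv, convolution_eq_swap, InnerProductSpace.toDual_symm_apply,
    ContinuousLinearMap.integral_apply (convolutionExistsAt_iff_integrable_swap.1 hex),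
    real_inner_comm, ← integral_inner hI]
  refine integral_congr_ae (Eventually.of_forall fun t => ?_)
  simp only [inner_smul_right, inner_gradient_right]
  simp [mul_comm]

theorem norm_graphSpace_le {N : ℕ} {Ω : Set (RN N)} (v : GraphSpace Ω) :
    ‖v‖ ≤ ‖v.fst‖ + ‖v.snd‖ := by
  have := WithLp.prod_norm_sq_eq_of_L2 v
  nlinarith [norm_nonneg v, norm_nonneg v.fst, norm_nonneg v.snd]

open scoped Convolution in
/-- An `H^1(ℝ^N)` function supported in a compact subset of the open set `Ω` is in `H^1_0(Ω)`. -/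
theorem IsWeakH1.exists_H10 {N : ℕ} {v : RN N → ℝ} {V : RN N → RN N} (h : IsWeakH1 v V)
    {Ω C : Set (RN N)} (hΩ : IsOpen Ω) (hC : IsCompact C) (hCΩ : C ⊆ Ω)
    (hv : Function.support v ⊆ C) :
    ∃ u : H10 Ω, H10.fn u =ᵐ[vol Ω] v ∧ H10.grad u =ᵐ[vol Ω] V := by
  let u : GraphSpace Ω := WithLp.toLp 2 ((h.memLp.restrict Ω).toLp v, (h.memLp_grad.restrict Ω).toLp V)
  suffices hu : u ∈ H10 Ω from
    ⟨⟨u, hu⟩, (h.memLp.restrict Ω).coeFn_toLp, (h.memLp_grad.restrict Ω).coeFn_toLp⟩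
  change u ∈ closure (testPairs Ω : Set (GraphSpace Ω))
  rw [Metric.mem_closure_iff]
  intro e he
  have he' : (0 : ℝ≥0∞) < ENNReal.ofReal (e / 3) := by simpa using by positivity
  obtain ⟨δ₁, hδ₁, h1⟩ := exists_eLpNorm_mollify_sub_le h.memLp he'
  obtain ⟨δ₂, hδ₂, h2⟩ := exists_eLpNorm_mollify_sub_le h.memLp_grad he'
  obtain ⟨δ₃, hδ₃, h3⟩ := hC.exists_cthickening_subset_open hΩ hCΩ
  -- The radii `δ₁` and `δ₂` control the errors on `v` and `V`; `δ₃` keeps the support of the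
  -- mollification inside `Ω`.
  let δ := min δ₁ (min δ₂ δ₃)
  have hδ : 0 < δ := lt_min hδ₁ (lt_min hδ₂ hδ₃)
  let ψ : ContDiffBump (0 : RN N) := ⟨δ / 2, δ, by positivity, by linarith⟩
  specialize h1 ψ (min_le_left _ _)
  specialize h2 ψ ((min_le_right _ _).trans (min_le_left _ _))
  have hψ3 : ψ.rOut ≤ δ₃ := (min_le_right _ _).trans (min_le_right _ _)
  set φ : RN N → ℝ := ψ.normed volume ⋆[ContinuousLinearMap.lsmul ℝ ℝ, volume] v with hφdef
  have hgrad : gradient φ = ψ.normed volume ⋆[ContinuousLinearMap.lsmul ℝ ℝ, volume] V :=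
    funext (h.gradient_mollify ψ)
  have hsupp : tsupport φ ⊆ Metric.cthickening δ₃ C := by
    refine closure_minimal ?_ Metric.isClosed_cthickening
    refine (support_convolution_subset (ContinuousLinearMap.lsmul ℝ ℝ)).trans ?_
    rw [ψ.support_normed_eq]
    rintro _ ⟨a, ha, b, hb, rfl⟩
    refine Metric.mem_cthickening_of_dist_le _ b _ _ (hv hb) ?_
    rw [mem_ball_zero_iff] at ha
    simpa using ha.le.trans hψ3
  have hφ : IsTest Ω φ := by
    refine ⟨ψ.hasCompactSupport_normed.contDiff_convolution_left _ ψ.contDiff_normed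
      (h.memLp.locallyIntegrable (by norm_num)), ?_, hsupp.trans h3⟩
    exact hC.cthickening.of_isClosed_subset (isClosed_tsupport _) hsupp
  have m1 : MemLp φ 2 (vol Ω) :=
    (hφ.continuous.memLp_of_hasCompactSupport hφ.compact).restrict Ω
  have m2 : MemLp (gradient φ) 2 (vol Ω) :=
    (hφ.continuous_gradient.memLp_of_hasCompactSupport hφ.hasCompactSupport_gradient).restrict Ω
  refine ⟨WithLp.toLp 2 (m1.toLp φ, m2.toLp _), ⟨φ, hφ, m1.coeFn_toLp, m2.coeFn_toLp⟩, ?_⟩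
  rw [dist_comm, dist_eq_norm]
  refine (norm_graphSpace_le _).trans_lt ?_
  have n1 : ‖m1.toLp φ - (h.memLp.restrict Ω).toLp v‖ ≤ e / 3 := by
    rw [← MemLp.toLp_sub, Lp.norm_toLp]
    refine ENNReal.toReal_le_of_le_ofReal (by positivity) ?_
    exact (eLpNorm_mono_measure _ Measure.restrict_le_self).trans h1
  have n2 : ‖m2.toLp (gradient φ) - (h.memLp_grad.restrict Ω).toLp V‖ ≤ e / 3 := by
    rw [← MemLp.toLp_sub, Lp.norm_toLp]
    refine ENNReal.toReal_le_of_le_ofReal (by positivity) ?_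
    refine (eLpNorm_mono_measure _ Measure.restrict_le_self).trans ?_
    rw [hgrad]
    exact h2
  calc _ ≤ e / 3 + e / 3 := add_le_add n1 n2
    _ < e := by linarith

/-- Multiplication by a test function maps `H^1(ℝ^N)` into `H^1_0`. -/
theorem IsWeakH1.exists_H10_mul_test {N : ℕ} {r : RN N → ℝ} {R : RN N → RN N}
    (h : IsWeakH1 r R) {Ω : Set (RN N)} (hΩ : IsOpen Ω) {φ : RN N → ℝ} (hφ : IsTest Ω φ) :
    ∃ u : H10 Ω, H10.fn u =ᵐ[vol Ω] (fun x => φ x * r x) ∧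
      H10.grad u =ᵐ[vol Ω] fun x => r x • gradient φ x + φ x • R x :=
  (h.mul_test hφ).exists_H10 hΩ hφ.compact hφ.subset fun x hx => by
    refine subset_tsupport _ fun h0 => hx ?_
    simp [h0]

/-! ### The Poincaré inequality. -/

theorem IsTest.integrable_sq {N : ℕ} {U : Set (RN N)} {φ : RN N → ℝ} (hφ : IsTest U φ) :
    Integrable (fun x => φ x ^ 2) volume :=
  (hφ.continuous.memLp_of_hasCompactSupport hφ.compact).integrable_sq

theorem IsTest.integrable_norm_gradient_sq {N : ℕ} {U : Set (RN N)} {φ : RN N → ℝ}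
    (hφ : IsTest U φ) : Integrable (fun x => ‖gradient φ x‖ ^ 2) volume :=
  (hφ.continuous_gradient.memLp_of_hasCompactSupport
    hφ.hasCompactSupport_gradient).integrable_norm_pow (p := 2) (by norm_num)

theorem fderiv_coord {N : ℕ} (i : Fin N) (x v : RN N) : fderiv ℝ (fun x : RN N => x i) x v = v i := by
  have h : (fun x : RN N => x i) = (EuclideanSpace.proj i : RN N →L[ℝ] ℝ) := by
    ext; simp
  rw [h, ContinuousLinearMap.fderiv]
  simp

/-- The Poincaré inequality for test functions with support in a ball. -/
theorem IsTest.poincare {N : ℕ} (i : Fin N) {Ω : Set (RN N)} {ρ : ℝ} (hρ : ∀ x ∈ Ω, ‖x‖ ≤ ρ)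
    {φ : RN N → ℝ} (hφ : IsTest Ω φ) :
    ∫ x, φ x ^ 2 ≤ 4 * ρ ^ 2 * ∫ x, ‖gradient φ x‖ ^ 2 := by
  let e : RN N := EuclideanSpace.single i 1
  have he : ‖e‖ = 1 := by simp [e]
  have hφ2 : IsTest Ω (fun x => φ x * φ x) := hφ.mul hφ.smooth
  have hc : Continuous fun x : RN N => x i := by fun_prop
  have hd : ∀ x, fderiv ℝ (fun x => φ x * φ x) x e = inner ℝ e (gradient (fun x => φ x * φ x) x) :=
    fun x => by rw [inner_gradient_right]; simp
  have hc' : Continuous fun x => fderiv ℝ (fun x => φ x * φ x) x e := by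
    simp only [hd]
    exact continuous_const.inner hφ2.continuous_gradient
  have hs' : HasCompactSupport fun x => fderiv ℝ (fun x => φ x * φ x) x e :=
    hφ2.compact.fderiv_apply ℝ e
  -- Since `∂_i x_i = 1`, integration by parts gives `∫ φ² = -∫ x_i ∂_i(φ²)`.
  have hparts := integral_mul_fderiv_eq_neg_fderiv_mul_of_integrable (μ := volume)
    (f := fun x : RN N => x i) (g := fun x => φ x * φ x) (v := e)
    (by
      simp only [fderiv_coord]
      exact (hφ2.continuous.integrable_of_hasCompactSupport hφ2.compact).const_mul _)
    ((hc.mul hc').integrable_of_hasCompactSupport hs'.mul_left)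
    ((hc.mul hφ2.continuous).integrable_of_hasCompactSupport hφ2.compact.mul_left)
    (fun x _ => by fun_prop) (fun x _ => hφ2.differentiableAt x)
  have h1 : ∫ x, φ x ^ 2 = - ∫ x : RN N, x i * fderiv ℝ (fun x => φ x * φ x) x e := by
    rw [hparts, neg_neg]
    refine integral_congr_ae (Eventually.of_forall fun x => ?_)
    simp only [fderiv_coord, e]
    simp [sq]
  have h2 : ∫ x, φ x ^ 2 ≤ ∫ x, (1 / 2 * φ x ^ 2 + 2 * ρ ^ 2 * ‖gradient φ x‖ ^ 2) := by
    rw [h1, ← integral_neg]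
    refine integral_mono ((hc.mul hc').integrable_of_hasCompactSupport hs'.mul_left).neg
      ((hφ.integrable_sq.const_mul _).add (hφ.integrable_norm_gradient_sq.const_mul _))
      fun x => ?_
    simp only [hd]
    by_cases hx : x ∈ Ω
    · rw [gradient_mul (hφ.differentiableAt x) (hφ.differentiableAt x), inner_add_right,
        inner_smul_right]
      have h3 : |inner ℝ e (gradient φ x)| ≤ ‖gradient φ x‖ := by
        simpa [he] using abs_real_inner_le_norm e (gradient φ x)
      have h4 : |x i| ≤ ρ := (PiLp.norm_apply_le x i).trans (hρ x hx)
      have h5 : |x i * inner ℝ e (gradient φ x)| ≤ ρ * ‖gradient φ x‖ := by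
        rw [abs_mul]
        exact mul_le_mul h4 h3 (abs_nonneg _) ((abs_nonneg _).trans h4)
      have h6 : (x i * inner ℝ e (gradient φ x)) ^ 2 ≤ (ρ * ‖gradient φ x‖) ^ 2 :=
        sq_le_sq' (abs_le.1 h5).1 (abs_le.1 h5).2
      -- This square gives `-2φa ≤ φ²/2 + 2a²` with `a = x_i ∂_iφ`; absorbing the half of `φ²`
      -- yields the constant `4ρ²`.
      nlinarith [sq_nonneg (φ x + 2 * (x i * inner ℝ e (gradient φ x)))]
    · rw [hφ2.gradient_eq_zero hx]
      simp only [inner_zero_right, mul_zero, neg_zero]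
      positivity
  rw [integral_add (hφ.integrable_sq.const_mul _) (hφ.integrable_norm_gradient_sq.const_mul _),
    integral_const_mul, integral_const_mul] at h2
  linarith

theorem Lp_norm_sq_eq {N : ℕ} {Ω : Set (RN N)} {F : Type*} [NormedAddCommGroup F]
    [InnerProductSpace ℝ F] (v : Lp F 2 (vol Ω)) : ‖v‖ ^ 2 = ∫ x in Ω, ‖v x‖ ^ 2 := by
  rw [← real_inner_self_eq_norm_sq, L2.inner_def]
  simp

/-- The Poincaré inequality in `H^1_0(Ω)`. -/
theorem H10.exists_norm_sq_le {N : ℕ} (hN : 1 ≤ N) {Ω : Set (RN N)}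
    (hΩ : Bornology.IsBounded Ω) :
    ∃ C : ℝ, 0 < C ∧ ∀ u : H10 Ω, ‖u‖ ^ 2 ≤ C * ‖H10.grad u‖ ^ 2 := by
  obtain ⟨ρ, hρ⟩ := hΩ.exists_norm_le
  refine ⟨4 * ρ ^ 2 + 1, by positivity, fun u => ?_⟩
  -- The inequality is a closed condition, so it passes from test functions to their closure.
  have hclosed : IsClosed {v : GraphSpace Ω | ‖v‖ ^ 2 ≤ (4 * ρ ^ 2 + 1) * ‖v.snd‖ ^ 2} :=
    isClosed_le (by fun_prop) (by fun_prop)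
  have hsub : (testPairs Ω : Set (GraphSpace Ω)) ⊆
      {v : GraphSpace Ω | ‖v‖ ^ 2 ≤ (4 * ρ ^ 2 + 1) * ‖v.snd‖ ^ 2} := by
    rintro v ⟨φ, hφ, h1, h2⟩
    have e1 : ‖v.fst‖ ^ 2 = ∫ x, φ x ^ 2 := by
      rw [Lp_norm_sq_eq, ← setIntegral_eq_integral_of_forall_compl_eq_zero (μ := volume) (s := Ω)
        (fun x hx => by rw [hφ.eq_zero hx]; simp)]
      refine integral_congr_ae ?_
      filter_upwards [h1] with x hx
      rw [hx, Real.norm_eq_abs, sq_abs]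
    have e2 : ‖v.snd‖ ^ 2 = ∫ x, ‖gradient φ x‖ ^ 2 := by
      rw [Lp_norm_sq_eq, ← setIntegral_eq_integral_of_forall_compl_eq_zero (μ := volume) (s := Ω)
        (fun x hx => by rw [hφ.gradient_eq_zero hx]; simp)]
      refine integral_congr_ae ?_
      filter_upwards [h2] with x hx
      rw [hx]
    have := hφ.poincare ⟨0, hN⟩ hρ
    rw [← e1, ← e2] at this
    change ‖v‖ ^ 2 ≤ (4 * ρ ^ 2 + 1) * ‖v.snd‖ ^ 2
    rw [WithLp.prod_norm_sq_eq_of_L2]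
    linarith
  exact closure_minimal hsub hclosed u.2

/-! ### Coefficient operators and the Dirichlet problem. -/

theorem aestronglyMeasurable_flux {N : ℕ} {μ : Measure (RN N)} {A : RN N → Mat N}
    (hA : ∀ i j, AEMeasurable (fun x => A x i j) μ) {G : RN N → RN N}
    (hG : AEStronglyMeasurable G μ) : AEStronglyMeasurable (flux A G) μ := by
  refine AEMeasurable.aestronglyMeasurable ?_
  have h : AEMeasurable (fun x i => ∑ j, A x i j * G x j) μ := by
    refine aemeasurable_pi_lambda _ fun i => ?_
    refine Finset.aemeasurable_fun_sum _ fun j _ => (hA i j).mul ?_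
    exact (EuclideanSpace.proj j : RN N →L[ℝ] ℝ).continuous.measurable.comp_aemeasurable hG.aemeasurable
  have h2 := (WithLp.measurable_toLp 2 (Fin N → ℝ)).comp_aemeasurable h
  refine h2.congr (Eventually.of_forall fun x => ?_)
  ext i
  simp [flux, Matrix.mulVec, dotProduct, Matrix.toLpLin_apply]

theorem IsCoeff.memLp_flux {N : ℕ} {α β : ℝ} {Ω : Set (RN N)} {A : RN N → Mat N}
    (hA : IsCoeff α β Ω A) {G : RN N → RN N} (hG : MemLp G 2 (vol Ω)) :
    MemLp (flux A G) 2 (vol Ω) :=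
  hG.of_le_mul (aestronglyMeasurable_flux hA.aemeasurable hG.1)
    (hA.bounded.mono fun x hx => hx (G x))

theorem inner_toEuclideanLin_comm {N : ℕ} {A : Mat N} (hA : ∀ i j, A i j = A j i) (ξ η : RN N) :
    inner ℝ (Matrix.toEuclideanLin A ξ) η = inner ℝ ξ (Matrix.toEuclideanLin A η) := by
  have : A.IsHermitian := by
    ext i j
    simp [hA i j]
  exact (Matrix.isSymmetric_toEuclideanLin_iff.2 this) ξ η

/-- Multiplication by the coefficient field `A` as an operator on `L²(Ω)^N`. -/
noncomputable def IsCoeff.op {N : ℕ} {α β : ℝ} {Ω : Set (RN N)} {A : RN N → Mat N}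
    (hA : IsCoeff α β Ω A) : Lp (RN N) 2 (vol Ω) →L[ℝ] Lp (RN N) 2 (vol Ω) :=
  LinearMap.mkContinuous
    { toFun := fun G => (hA.memLp_flux (Lp.memLp G)).toLp _
      map_add' := fun G H => by
        rw [← MemLp.toLp_add]
        refine MemLp.toLp_congr _ _ ?_
        filter_upwards [Lp.coeFn_add G H] with x hx
        simp only [flux, hx, Pi.add_apply, map_add]
      map_smul' := fun c G => by
        rw [RingHom.id_apply, ← MemLp.toLp_const_smul]
        refine MemLp.toLp_congr _ _ ?_
        filter_upwards [Lp.coeFn_smul c G] with x hx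
        simp only [flux, hx, Pi.smul_apply, map_smul] }
    -- The sign of `β` is not part of `IsCoeff`, hence the absolute value.
    |β| fun G => by
      refine Lp.norm_le_mul_norm_of_ae_le_mul ?_
      filter_upwards [(hA.memLp_flux (Lp.memLp G)).coeFn_toLp, hA.bounded] with x h1 h2
      refine (le_of_eq (congrArg norm h1)).trans ((h2 _).trans ?_)
      gcongr
      exact le_abs_self β

theorem IsCoeff.coeFn_op {N : ℕ} {α β : ℝ} {Ω : Set (RN N)} {A : RN N → Mat N}
    (hA : IsCoeff α β Ω A) (G : Lp (RN N) 2 (vol Ω)) : hA.op G =ᵐ[vol Ω] flux A G :=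
  (hA.memLp_flux (Lp.memLp G)).coeFn_toLp

theorem IsCoeff.norm_op_le {N : ℕ} {α β : ℝ} {Ω : Set (RN N)} {A : RN N → Mat N}
    (hA : IsCoeff α β Ω A) (G : Lp (RN N) 2 (vol Ω)) : ‖hA.op G‖ ≤ |β| * ‖G‖ :=
  (hA.op.le_opNorm G).trans (mul_le_mul_of_nonneg_right
    (LinearMap.mkContinuous_norm_le _ (abs_nonneg _) _) (norm_nonneg _))

theorem IsCoeff.inner_op {N : ℕ} {α β : ℝ} {Ω : Set (RN N)} {A : RN N → Mat N}
    (hA : IsCoeff α β Ω A) (G H : Lp (RN N) 2 (vol Ω)) :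
    inner ℝ (hA.op G) H = ∫ x in Ω, inner ℝ (flux A G x) (H x) := by
  rw [L2.inner_def]
  refine integral_congr_ae ?_
  filter_upwards [hA.coeFn_op G] with x hx
  rw [hx]

theorem IsCoeff.inner_op_comm {N : ℕ} {α β : ℝ} {Ω : Set (RN N)} {A : RN N → Mat N}
    (hA : IsCoeff α β Ω A) (G H : Lp (RN N) 2 (vol Ω)) :
    inner ℝ (hA.op G) H = inner ℝ G (hA.op H) := by
  rw [hA.inner_op, real_inner_comm (hA.op H) G, hA.inner_op]
  refine integral_congr_ae ?_
  filter_upwards [hA.symm] with x hx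
  exact (inner_toEuclideanLin_comm hx _ _).trans (real_inner_comm _ _)

theorem IsCoeff.le_inner_op {N : ℕ} {α β : ℝ} {Ω : Set (RN N)} {A : RN N → Mat N}
    (hA : IsCoeff α β Ω A) (G : Lp (RN N) 2 (vol Ω)) : α * ‖G‖ ^ 2 ≤ inner ℝ (hA.op G) G := by
  rw [Lp_norm_sq_eq, ← integral_const_mul, L2.inner_def]
  refine integral_mono_ae ?_ (L2.integrable_inner _ _) ?_
  · exact ((Lp.memLp G).integrable_norm_pow (p := 2) (by norm_num)).const_mul _
  · filter_upwards [hA.coeFn_op G, hA.coercive] with x h1 h2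
    rw [h1]
    exact h2 _

instance H10.completeSpace {N : ℕ} (Ω : Set (RN N)) : CompleteSpace (H10 Ω) :=
  (testPairs Ω).isClosed_topologicalClosure.completeSpace_coe

/-- The gradient as a continuous linear map on `H^1_0(Ω)`. -/
noncomputable def H10.gradL {N : ℕ} (Ω : Set (RN N)) : H10 Ω →L[ℝ] Lp (RN N) 2 (vol Ω) :=
  (WithLp.sndL 2 ℝ _ _).comp (H10 Ω).subtypeL

/-- The embedding of `H^1_0(Ω)` in `L²(Ω)` as a continuous linear map. -/
noncomputable def H10.fnL {N : ℕ} (Ω : Set (RN N)) : H10 Ω →L[ℝ] Lp ℝ 2 (vol Ω) :=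
  (WithLp.fstL 2 ℝ _ _).comp (H10 Ω).subtypeL

theorem H10.norm_grad_le {N : ℕ} {Ω : Set (RN N)} (u : H10 Ω) : ‖H10.grad u‖ ≤ ‖u‖ := by
  have h := WithLp.prod_norm_sq_eq_of_L2 (u : GraphSpace Ω)
  change ‖u‖ ^ 2 = ‖H10.fn u‖ ^ 2 + ‖H10.grad u‖ ^ 2 at h
  nlinarith [norm_nonneg u, norm_nonneg (H10.grad u), sq_nonneg ‖H10.fn u‖]

theorem H10.norm_fn_le {N : ℕ} {Ω : Set (RN N)} (u : H10 Ω) : ‖H10.fn u‖ ≤ ‖u‖ := by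
  have h := WithLp.prod_norm_sq_eq_of_L2 (u : GraphSpace Ω)
  change ‖u‖ ^ 2 = ‖H10.fn u‖ ^ 2 + ‖H10.grad u‖ ^ 2 at h
  nlinarith [norm_nonneg u, norm_nonneg (H10.fn u), sq_nonneg ‖H10.grad u‖]

/-- The bilinear form `∫ A∇u·∇v` on `H^1_0(Ω)`. -/
noncomputable def IsCoeff.form {N : ℕ} {α β : ℝ} {Ω : Set (RN N)} {A : RN N → Mat N}
    (hA : IsCoeff α β Ω A) : H10 Ω →L[ℝ] H10 Ω →L[ℝ] ℝ :=
  (innerSL ℝ).bilinearComp (hA.op.comp (H10.gradL Ω)) (H10.gradL Ω)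

theorem IsCoeff.form_apply {N : ℕ} {α β : ℝ} {Ω : Set (RN N)} {A : RN N → Mat N}
    (hA : IsCoeff α β Ω A) (u v : H10 Ω) :
    hA.form u v = inner ℝ (hA.op (H10.grad u)) (H10.grad v) := rfl

theorem IsCoeff.isDirichletSolution_iff {N : ℕ} {α β : ℝ} {Ω : Set (RN N)} {A : RN N → Mat N}
    (hA : IsCoeff α β Ω A) {f : Lp ℝ 2 (vol Ω)} {u : H10 Ω} :
    IsDirichletSolution A f u ↔ ∀ v, hA.form u v = inner ℝ f (H10.fn v) := by
  refine forall_congr' fun v => ?_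
  rw [hA.form_apply, hA.inner_op, L2.inner_def]
  simp only [RCLike.inner_apply, conj_trivial, mul_comm]

/-- A common coercivity constant for all coefficients with lower bound `α`. -/
theorem IsCoeff.exists_coercive {N : ℕ} (hN : 1 ≤ N) {Ω : Set (RN N)}
    (hΩ : Bornology.IsBounded Ω) {α : ℝ} (hα : 0 < α) :
    ∃ c : ℝ, 0 < c ∧ ∀ {β : ℝ} {A : RN N → Mat N} (hA : IsCoeff α β Ω A) (u : H10 Ω),
      c * ‖u‖ * ‖u‖ ≤ hA.form u u := by
  obtain ⟨C, hC, h⟩ := H10.exists_norm_sq_le hN hΩ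
  refine ⟨α / C, by positivity, fun hA u => ?_⟩
  rw [hA.form_apply]
  refine le_trans ?_ (hA.le_inner_op _)
  have h1 := h u
  calc α / C * ‖u‖ * ‖u‖ = α * (‖u‖ ^ 2 / C) := by ring
    _ ≤ α * ‖H10.grad u‖ ^ 2 := by
      gcongr
      rw [div_le_iff₀ hC]
      linarith

theorem IsCoeff.isCoercive {N : ℕ} (hN : 1 ≤ N) {Ω : Set (RN N)} (hΩ : Bornology.IsBounded Ω)
    {α β : ℝ} (hα : 0 < α) {A : RN N → Mat N} (hA : IsCoeff α β Ω A) : IsCoercive hA.form := by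
  obtain ⟨c, hc, h⟩ := IsCoeff.exists_coercive hN hΩ hα
  exact ⟨c, hc, fun u => h hA u⟩

/-- The Dirichlet problem is uniquely solvable. -/
theorem IsCoeff.existsUnique_isDirichletSolution {N : ℕ} (hN : 1 ≤ N) {Ω : Set (RN N)}
    (hΩ : Bornology.IsBounded Ω) {α β : ℝ} (hα : 0 < α) {A : RN N → Mat N}
    (hA : IsCoeff α β Ω A) (f : Lp ℝ 2 (vol Ω)) : ∃! u : H10 Ω, IsDirichletSolution A f u := by
  have hc := hA.isCoercive hN hΩ hα
  -- Lax–Milgram, applied to the functional `v ↦ ∫ f v`.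
  let T : StrongDual ℝ (H10 Ω) := (innerSL ℝ f).comp (H10.fnL Ω)
  have hT : ∀ v, inner ℝ ((InnerProductSpace.toDual ℝ (H10 Ω)).symm T) v = inner ℝ f (H10.fn v) :=
    fun v => InnerProductSpace.toDual_symm_apply
  refine ⟨hc.continuousLinearEquivOfBilin.symm ((InnerProductSpace.toDual ℝ (H10 Ω)).symm T),
    ?_, fun w hw => ?_⟩
  · refine hA.isDirichletSolution_iff.2 fun v => ?_
    rw [← hc.continuousLinearEquivOfBilin_apply, ContinuousLinearEquiv.apply_symm_apply, hT]
  · have hw' := hA.isDirichletSolution_iff.1 hw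
    rw [ContinuousLinearEquiv.eq_symm_apply]
    refine ext_inner_right ℝ fun v => ?_
    rw [hc.continuousLinearEquivOfBilin_apply, hw', hT]

/-- Test the equation with `u` itself. With `c` from `IsCoeff.exists_coercive` the bound is the same
for all coefficients with lower bound `α`, hence uniform along the sequence. -/
theorem norm_le_of_coercive {N : ℕ} {Ω : Set (RN N)} {α β c : ℝ} (hc : 0 < c) {A : RN N → Mat N}
    (hA : IsCoeff α β Ω A) (h : ∀ u, c * ‖u‖ * ‖u‖ ≤ hA.form u u) {f : Lp ℝ 2 (vol Ω)}
    {u : H10 Ω} (hu : IsDirichletSolution A f u) : ‖u‖ ≤ ‖f‖ / c := by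
  have h1 := h u
  rw [hA.isDirichletSolution_iff.1 hu] at h1
  have h2 : c * ‖u‖ * ‖u‖ ≤ ‖f‖ * ‖u‖ := h1.trans <|
    (real_inner_le_norm _ _).trans (mul_le_mul_of_nonneg_left (H10.norm_fn_le u) (norm_nonneg _))
  rcases (norm_nonneg u).eq_or_lt with h0 | h0
  · rw [← h0]; positivity
  · rw [le_div_iff₀ hc, mul_comm]
    exact le_of_mul_le_mul_right h2 h0

/-! ### Reduction to the convergence of fluxes in the sense of distributions. -/

theorem IsTest.memLp_smul_const {N : ℕ} {Ω : Set (RN N)} {φ : RN N → ℝ} (hφ : IsTest Ω φ)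
    (l : RN N) : MemLp (fun x => φ x • l) 2 (vol Ω) :=
  ((hφ.continuous.smul continuous_const).memLp_of_hasCompactSupport
    hφ.compact.smul_right).restrict Ω

/-- The fields `φ l`, with `φ` a test function and `l` a vector, are total in `L²(Ω)^N`. -/
theorem eq_zero_of_inner_test_eq_zero {N : ℕ} {Ω : Set (RN N)} (hΩ : IsOpen Ω)
    {h : Lp (RN N) 2 (vol Ω)}
    (h0 : ∀ s ∈ {s : Lp (RN N) 2 (vol Ω) | ∃ (φ : RN N → ℝ) (l : RN N), IsTest Ω φ ∧
      s =ᵐ[vol Ω] fun x => φ x • l}, inner ℝ s h = 0) : h = 0 := by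
  have hm : MemLp (Ω.indicator h) 2 volume :=
    (memLp_indicator_iff_restrict hΩ.measurableSet).2 (Lp.memLp h)
  have hloc := hm.locallyIntegrable (by norm_num)
  have hind : ∀ x ∈ Ω, Ω.indicator h x = h x := fun x hx => indicator_of_mem hx _
  have hae : ∀ᵐ x, x ∈ Ω → Ω.indicator h x = 0 := by
    refine hΩ.ae_eq_zero_of_integral_contDiff_smul_eq_zero (hloc.locallyIntegrableOn Ω) ?_
    intro φ h1 h2 h3
    have hφ : IsTest Ω φ := ⟨h1, h2, h3⟩
    have hi := hloc.smul_test hφ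
    refine ext_inner_left ℝ fun l => ?_
    rw [← integral_inner hi, inner_zero_right]
    have h4 := h0 ((hφ.memLp_smul_const l).toLp _) ⟨φ, l, hφ, MemLp.coeFn_toLp _⟩
    rw [L2.inner_def] at h4
    rw [← h4, ← setIntegral_eq_integral_of_forall_compl_eq_zero (μ := volume) (s := Ω)
      (fun x hx => by rw [hφ.eq_zero hx]; simp)]
    refine integral_congr_ae ?_
    filter_upwards [(hφ.memLp_smul_const l).coeFn_toLp, ae_restrict_mem hΩ.measurableSet]
      with x hx hxΩ
    rw [hx, hind x hxΩ, real_inner_smul_left, real_inner_smul_right]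
  rw [Lp.eq_zero_iff_ae_eq_zero]
  refine (ae_restrict_iff' hΩ.measurableSet).2 ?_
  filter_upwards [hae] with x hx hxΩ
  rw [← hind x hxΩ]
  exact hx hxΩ

/-- Solutions and fluxes converge weakly to those of the constant matrix `M` as soon as
`A^n∇u^n - M∇u^n → 0` in the sense of distributions. -/
theorem weakTendsto_of_flux_sub_tendsto {N : ℕ} (hN : 1 ≤ N) {Ω : Set (RN N)} (hΩ : IsOpen Ω)
    (hΩb : Bornology.IsBounded Ω) {α β α' β' : ℝ} (hα : 0 < α) (hα' : 0 < α')
    {A : ℕ → RN N → Mat N} (hA : ∀ n, IsCoeff α β Ω (A n)) {M : Mat N}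
    (hM : IsCoeff α' β' Ω fun _ => M) {f : Lp ℝ 2 (vol Ω)} {u : ℕ → H10 Ω}
    (hu : ∀ n, IsDirichletSolution (A n) f (u n))
    (hlim : ∀ (φ : RN N → ℝ) (l : RN N), IsTest Ω φ →
      Tendsto (fun n => ∫ x in Ω, φ x * (inner ℝ (flux (A n) (H10.grad (u n)) x) l -
        inner ℝ (Matrix.toEuclideanLin M l) (H10.grad (u n) x))) atTop (𝓝 0)) :
    ∃ u₀ : H10 Ω, WeakTendsto u u₀ ∧
      (∃ (hσ : ∀ n, MemLp (flux (A n) (H10.grad (u n))) 2 (vol Ω))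
        (hσ₀ : MemLp (flux (fun _ => M) (H10.grad u₀)) 2 (vol Ω)),
        WeakTendsto (fun n => (hσ n).toLp _) (hσ₀.toLp _)) ∧
      IsDirichletSolution (fun _ => M) f u₀ := by
  obtain ⟨c, hc, hcoer⟩ := IsCoeff.exists_coercive hN hΩb hα
  have hub : ∀ n, ‖u n‖ ≤ ‖f‖ / c := fun n => norm_le_of_coercive hc (hA n) (hcoer (hA n)) (hu n)
  have hgb : ∀ n, ‖H10.grad (u n)‖ ≤ ‖f‖ / c := fun n => (H10.norm_grad_le _).trans (hub n)
  let d : ℕ → Lp (RN N) 2 (vol Ω) := fun n => (hA n).op (H10.grad (u n)) - hM.op (H10.grad (u n))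
  have hdb : ∀ n, ‖d n‖ ≤ |β| * (‖f‖ / c) + |β'| * (‖f‖ / c) := fun n => by
    refine (norm_sub_le _ _).trans (add_le_add ?_ ?_)
    · exact ((hA n).norm_op_le _).trans (mul_le_mul_of_nonneg_left (hgb n) (abs_nonneg _))
    · exact (hM.norm_op_le _).trans (mul_le_mul_of_nonneg_left (hgb n) (abs_nonneg _))
  have hd : ∀ z, Tendsto (fun n => inner ℝ z (d n)) atTop (𝓝 0) := by
    refine tendsto_inner_zero_of_total hdb _ (fun z => eq_zero_of_inner_test_eq_zero hΩ) ?_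
    rintro s ⟨φ, l, hφ, hs⟩
    refine (hlim φ l hφ).congr fun n => ?_
    rw [L2.inner_def]
    refine integral_congr_ae ?_
    filter_upwards [hs, Lp.coeFn_sub ((hA n).op (H10.grad (u n))) (hM.op (H10.grad (u n))),
      (hA n).coeFn_op (H10.grad (u n)), hM.coeFn_op (H10.grad (u n)), hM.symm]
      with x h1 h2 h3 h4 h5
    rw [h1, h2, Pi.sub_apply, h3, h4, real_inner_smul_left, inner_sub_right,
      real_inner_comm, inner_toEuclideanLin_comm h5]
    rfl
  -- The limit is produced directly as the solution for `M`, so no weak compactness is used.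
  obtain ⟨u₀, hu₀, -⟩ := hM.existsUnique_isDirichletSolution hN hΩb hα' f
  have hform : ∀ v, Tendsto (fun n => hM.form (u n) v) atTop (𝓝 (hM.form u₀ v)) := fun v => by
    have h1 : ∀ n, hM.form (u n) v = inner ℝ f (H10.fn v) - inner ℝ (H10.grad v) (d n) :=
      fun n => by
        rw [← (hA n).isDirichletSolution_iff.1 (hu n) v, (hA n).form_apply, hM.form_apply,
          inner_sub_right, real_inner_comm (H10.grad v), real_inner_comm (H10.grad v)]
        ring
    simp only [h1]
    rw [hM.isDirichletSolution_iff.1 hu₀]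
    simpa using (hd (H10.grad v)).const_sub (inner ℝ f (H10.fn v))
  have hweak : ∀ z, Tendsto (fun n => inner ℝ z (u n)) atTop (𝓝 (inner ℝ z u₀)) := fun z => by
    have hcM := hM.isCoercive hN hΩb hα'
    -- Coercivity and symmetry of the form of `M` turn an arbitrary inner product into a value of
    -- that form.
    have h1 : ∀ w : H10 Ω, inner ℝ z w = hM.form w (hcM.continuousLinearEquivOfBilin.symm z) :=
      fun w => by
        rw [hM.form_apply, hM.inner_op_comm, real_inner_comm _ (H10.grad w), ← hM.form_apply,
          ← hcM.continuousLinearEquivOfBilin_apply, ContinuousLinearEquiv.apply_symm_apply]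
    simp only [h1]
    exact hform _
  refine ⟨u₀, weakTendsto_of_inner hweak,
    ⟨fun n => (hA n).memLp_flux (Lp.memLp _), hM.memLp_flux (Lp.memLp _),
      weakTendsto_of_inner fun z => ?_⟩, hu₀⟩
  -- The flux is `d n` plus `M∇u^n`, and the second term is a continuous linear image of `u n`.
  let T : StrongDual ℝ (H10 Ω) := (innerSL ℝ z).comp (hM.op.comp (H10.gradL Ω))
  have hT : Tendsto (fun n => T (u n)) atTop (𝓝 (T u₀)) := by
    have := hweak ((InnerProductSpace.toDual ℝ (H10 Ω)).symm T)
    simpa only [InnerProductSpace.toDual_symm_apply] using this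
  have hsum := (hd z).add hT
  rw [zero_add] at hsum
  refine hsum.congr fun n => ?_
  change inner ℝ z (_ - hM.op (H10.grad (u n))) + inner ℝ z (hM.op (H10.grad (u n))) = _
  rw [← inner_add_right, sub_add_cancel]
  rfl

/-! ### Integration by parts against smooth functions. -/

/-- The weak gradient of a smooth function is its gradient. -/
theorem IsTest.integral_smul_gradient {N : ℕ} {φ : RN N → ℝ} (hφ : IsTest univ φ) {f : RN N → ℝ}
    (hf : ContDiff ℝ (⊤ : ℕ∞) f) :
    ∫ x, f x • gradient φ x = - ∫ x, φ x • gradient f x := by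
  have hfc : Continuous (gradient f) :=
    (InnerProductSpace.toDual ℝ (RN N)).symm.continuous.comp (hf.continuous_fderiv (by simp))
  have hfd : ∀ x, DifferentiableAt ℝ f x := fun x => (hf.differentiable (by simp)).differentiableAt
  have i1 : Integrable (fun x => f x • gradient φ x) :=
    (hf.continuous.smul hφ.continuous_gradient).integrable_of_hasCompactSupport
      hφ.hasCompactSupport_gradient.smul_left
  have i2 : Integrable (fun x => φ x • gradient f x) :=
    (hφ.continuous.smul hfc).integrable_of_hasCompactSupport hφ.compact.smul_right
  have i3 : Integrable (fun x => f x * φ x) :=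
    (hf.continuous.mul hφ.continuous).integrable_of_hasCompactSupport hφ.compact.mul_left
  refine ext_inner_left ℝ fun v => ?_
  rw [inner_neg_right, ← integral_inner i1, ← integral_inner i2]
  have e1 : ∀ x, inner ℝ v (f x • gradient φ x) = f x * fderiv ℝ φ x v := fun x => by
    rw [real_inner_smul_right, inner_gradient_right]; simp
  have e2 : ∀ x, inner ℝ v (φ x • gradient f x) = fderiv ℝ f x v * φ x := fun x => by
    rw [real_inner_smul_right, inner_gradient_right]; simp [mul_comm]
  have j1 := i1.const_inner (𝕜 := ℝ) v
  have j2 := i2.const_inner (𝕜 := ℝ) v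
  simp only [e1, e2] at j1 j2 ⊢
  exact integral_mul_fderiv_eq_neg_fderiv_mul_of_integrable j2 j1 i3 (fun x _ => hfd x)
    (fun x _ => hφ.differentiableAt x)

theorem IsTest.integral_gradient {N : ℕ} {φ : RN N → ℝ} (hφ : IsTest univ φ) :
    ∫ x, gradient φ x = 0 := by
  simpa [gradient_fun_const] using hφ.integral_smul_gradient (f := fun _ => 1) contDiff_const

theorem gradient_inner_const {N : ℕ} (l x : RN N) : gradient (fun x => inner ℝ l x) x = l := by
  have : HasFDerivAt (fun x => inner ℝ l x) (innerSL ℝ l) x := (innerSL ℝ l).hasFDerivAt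
  rw [gradient, this.fderiv]
  refine ext_inner_right ℝ fun v => ?_
  rw [InnerProductSpace.toDual_symm_apply]
  rfl

theorem contDiff_inner_const {N : ℕ} (l : RN N) :
    ContDiff ℝ (⊤ : ℕ∞) (fun x : RN N => (inner ℝ l x : ℝ)) := contDiff_const.inner ℝ contDiff_id

theorem IsTest.integral_inner_smul_gradient {N : ℕ} {φ : RN N → ℝ} (hφ : IsTest univ φ)
    (l : RN N) : ∫ x, (inner ℝ l x : ℝ) • gradient φ x = - ∫ x, φ x • l := by
  rw [hφ.integral_smul_gradient (contDiff_inner_const l)]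
  simp only [gradient_inner_const]

/-! ### Rescaling -/

/-- The affine map `x ↦ (x - y) / ε`. -/
noncomputable def rescale {N : ℕ} (ε : ℝ) (y x : RN N) : RN N := ε⁻¹ • (x - y)

theorem continuous_rescale {N : ℕ} (ε : ℝ) (y : RN N) : Continuous (rescale ε y) := by
  unfold rescale; fun_prop

theorem rescale_smul_add {N : ℕ} {ε : ℝ} (hε : 0 < ε) (y z : RN N) :
    rescale ε y (ε • z + y) = z := by
  simp [rescale, smul_smul, hε.ne']

theorem smul_rescale_add {N : ℕ} {ε : ℝ} (hε : 0 < ε) (y x : RN N) :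
    ε • rescale ε y x + y = x := by
  simp [rescale, smul_smul, hε.ne']

theorem mem_cell_iff {N : ℕ} {ω : Set (RN N)} {ε : ℝ} (hε : 0 < ε) {y x : RN N} :
    x ∈ cell ω ε y ↔ rescale ε y x ∈ ω := by
  constructor
  · rintro ⟨z, hz, rfl⟩
    simpa only [rescale_smul_add hε] using hz
  · exact fun h => ⟨_, h, smul_rescale_add hε y x⟩

theorem cell_eq_preimage {N : ℕ} {ω : Set (RN N)} {ε : ℝ} (hε : 0 < ε) (y : RN N) :
    cell ω ε y = rescale ε y ⁻¹' ω := by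
  ext x; exact mem_cell_iff hε

theorem isOpen_cell {N : ℕ} {ω : Set (RN N)} (hω : IsOpen ω) {ε : ℝ} (hε : 0 < ε) (y : RN N) :
    IsOpen (cell ω ε y) := by
  rw [cell_eq_preimage hε]
  exact hω.preimage (continuous_rescale ε y)

theorem map_rescale {N : ℕ} {ε : ℝ} (hε : 0 < ε) (y : RN N) :
    (volume : Measure (RN N)).map (rescale ε y) = ENNReal.ofReal (ε ^ N) • volume := by
  have h : rescale ε y = (fun z => ε⁻¹ • z) ∘ (fun x => x - y) := rfl
  rw [h, ← Measure.map_map (by fun_prop) (by fun_prop), map_sub_right_eq_self,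
    Measure.map_addHaar_smul _ (inv_ne_zero hε.ne')]
  simp [abs_of_pos hε]

theorem quasiMeasurePreserving_rescale {N : ℕ} {ε : ℝ} (hε : 0 < ε) (y : RN N) :
    Measure.QuasiMeasurePreserving (rescale ε y) volume volume :=
  ⟨(continuous_rescale ε y).measurable, by
    rw [map_rescale hε]
    exact Measure.smul_absolutelyContinuous⟩

theorem isHomeomorph_rescale {N : ℕ} {ε : ℝ} (hε : 0 < ε) (y : RN N) :
    IsHomeomorph (rescale ε y) :=
  Homeomorph.isHomeomorph ⟨⟨rescale ε y, fun z => ε • z + y, smul_rescale_add hε y,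
    rescale_smul_add hε y⟩, continuous_rescale ε y, by fun_prop⟩

theorem integral_comp_rescale {N : ℕ} {F : Type*} [NormedAddCommGroup F] [NormedSpace ℝ F]
    {ε : ℝ} (hε : 0 < ε) (y : RN N) (h : RN N → F) :
    ∫ x, h (rescale ε y x) = ε ^ N • ∫ z, h z := by
  rw [← (isHomeomorph_rescale hε y).isOpenEmbedding.measurableEmbedding.integral_map, map_rescale hε,
    integral_smul_measure, ENNReal.toReal_ofReal (by positivity)]

theorem MeasureTheory.MemLp.comp_rescale {N : ℕ} {F : Type*} [NormedAddCommGroup F] {h : RN N → F}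
    (hh : MemLp h 2 volume) {ε : ℝ} (hε : 0 < ε) (y : RN N) :
    MemLp (fun x => h (rescale ε y x)) 2 volume := by
  have : MemLp h 2 ((volume : Measure (RN N)).map (rescale ε y)) := by
    rw [map_rescale hε]
    exact hh.smul_measure ENNReal.ofReal_ne_top
  exact this.comp_of_map (continuous_rescale ε y).aemeasurable

theorem volume_cell {N : ℕ} {ω : Set (RN N)} (hω : IsOpen ω) {ε : ℝ} (hε : 0 < ε) (y : RN N) :
    volume (cell ω ε y) = ENNReal.ofReal (ε ^ N) * volume ω := by
  rw [cell_eq_preimage hε, ← Measure.map_apply (continuous_rescale ε y).measurable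
    hω.measurableSet, map_rescale hε, Measure.smul_apply, smul_eq_mul]

theorem IsTest.comp_dilation {N : ℕ} {ψ : RN N → ℝ} (hψ : IsTest univ ψ) {ε : ℝ} (hε : 0 < ε)
    (y : RN N) : IsTest univ (fun z => ψ (ε • z + y)) where
  smooth := hψ.smooth.comp (by fun_prop)
  compact := hψ.compact.comp_homeomorph (((Homeomorph.smulOfNeZero ε hε.ne').trans
    (Homeomorph.addRight y)))
  subset := subset_univ _

theorem IsTest.gradient_comp_dilation {N : ℕ} {ψ : RN N → ℝ} (hψ : IsTest univ ψ) (ε : ℝ)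
    (y z : RN N) : gradient (fun z => ψ (ε • z + y)) z = ε • gradient ψ (ε • z + y) := by
  have h : HasFDerivAt (fun z => ψ (ε • z + y)) _ z :=
    (hψ.differentiableAt (ε • z + y)).hasFDerivAt.comp z
      (((hasFDerivAt_id z).const_smul ε).add_const y)
  rw [gradient, h.fderiv]
  refine ext_inner_right ℝ fun v => ?_
  rw [InnerProductSpace.toDual_symm_apply, real_inner_smul_left, inner_gradient_left]
  simp

/-! ### Correctors, their rescaling and their existence. -/

/-- A corrector on the cell `c` in direction `l`: `r` vanishes off `c`, `R` is its weak gradient,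
and `A(l + R) = Ml + g` on `c` with `g` divergence free in `ℝ^N` and zero off `c`. -/
structure IsCorrector {N : ℕ} (c : Set (RN N)) (A : RN N → Mat N) (M : Mat N) (l : RN N)
    (r : RN N → ℝ) (R g : RN N → RN N) : Prop where
  isWeakH1 : IsWeakH1 r R
  memLp : MemLp g 2 volume
  fn_zero : ∀ᵐ x, x ∉ c → r x = 0
  grad_zero : ∀ᵐ x, x ∉ c → R x = 0
  zero : ∀ᵐ x, x ∉ c → g x = 0
  flux_eq : ∀ᵐ x, x ∈ c → Matrix.toEuclideanLin (A x) (l + R x) = Matrix.toEuclideanLin M l + g x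
  div_free : ∀ ψ : RN N → ℝ, IsTest univ ψ → ∫ x, inner ℝ (g x) (gradient ψ x) = 0

theorem IsCorrector.rescale {N : ℕ} {ω : Set (RN N)} {A : RN N → Mat N} {M : Mat N} {l : RN N}
    {r : RN N → ℝ} {R g : RN N → RN N} (h : IsCorrector ω A M l r R g) {ε : ℝ} (hε : 0 < ε)
    (y : RN N) :
    IsCorrector (cell ω ε y) (fun x => A (rescale ε y x)) M l (fun x => ε * r (rescale ε y x))
      (fun x => R (rescale ε y x)) (fun x => g (rescale ε y x)) where
  isWeakH1 := by
    refine ⟨(h.isWeakH1.memLp.comp_rescale hε y).const_mul ε,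
      h.isWeakH1.memLp_grad.comp_rescale hε y, fun ψ hψ => ?_⟩
    have hw := h.isWeakH1.weak_grad _ (hψ.comp_dilation hε y)
    have e1 : ∀ x, (ε * r (_root_.rescale ε y x)) • gradient ψ x = (fun z => r z •
        gradient (fun z => ψ (ε • z + y)) z) (_root_.rescale ε y x) := fun x => by
      simp only [hψ.gradient_comp_dilation, smul_rescale_add hε]
      module
    have e2 : ∀ x, ψ x • R (_root_.rescale ε y x) = (fun z => ψ (ε • z + y) • R z)
        (_root_.rescale ε y x) := fun x => by
      simp only [smul_rescale_add hε]
    rw [(integral_congr_ae (Eventually.of_forall e1)).trans (integral_comp_rescale hε y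
        fun z => r z • gradient (fun z => ψ (ε • z + y)) z),
      (integral_congr_ae (Eventually.of_forall e2)).trans (integral_comp_rescale hε y
        fun z => ψ (ε • z + y) • R z), hw, smul_neg]
  memLp := h.memLp.comp_rescale hε y
  fn_zero := by
    filter_upwards [(quasiMeasurePreserving_rescale hε y).ae h.fn_zero] with x hx hxc
    rw [hx (mt (mem_cell_iff hε).2 hxc), mul_zero]
  grad_zero := by
    filter_upwards [(quasiMeasurePreserving_rescale hε y).ae h.grad_zero] with x hx hxc
    exact hx (mt (mem_cell_iff hε).2 hxc)
  zero := by
    filter_upwards [(quasiMeasurePreserving_rescale hε y).ae h.zero] with x hx hxc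
    exact hx (mt (mem_cell_iff hε).2 hxc)
  flux_eq := by
    filter_upwards [(quasiMeasurePreserving_rescale hε y).ae h.flux_eq] with x hx hxc
    exact hx ((mem_cell_iff hε).1 hxc)
  div_free ψ hψ := by
    have hw := h.div_free _ (hψ.comp_dilation hε y)
    have e1 : ∀ x, inner ℝ (g (_root_.rescale ε y x)) (gradient ψ x) = (fun z => ε⁻¹ * inner ℝ (g z)
        (gradient (fun z => ψ (ε • z + y)) z)) (_root_.rescale ε y x) := fun x => by
      simp only [hψ.gradient_comp_dilation, smul_rescale_add hε, real_inner_smul_right]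
      rw [inv_mul_cancel_left₀ hε.ne']
    rw [(integral_congr_ae (Eventually.of_forall e1)).trans (integral_comp_rescale hε y
        fun z => ε⁻¹ * inner ℝ (g z) (gradient (fun z => ψ (ε • z + y)) z)), integral_const_mul, hw, mul_zero, smul_zero]

theorem MeasureTheory.MemLp.of_ae_zero {N : ℕ} {F : Type*} [NormedAddCommGroup F] {v : RN N → F}
    {C : Set (RN N)} (hC : MeasurableSet C) (hv : MemLp v 2 (vol C)) (h0 : ∀ᵐ x, x ∉ C → v x = 0) :
    MemLp v 2 volume := by
  refine ((memLp_indicator_iff_restrict hC).2 hv).ae_eq ?_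
  filter_upwards [h0] with x hx
  by_cases h : x ∈ C
  · rw [indicator_of_mem h]
  · rw [indicator_of_notMem h, hx h]

theorem integrable_inner_of_memLp {N : ℕ} {μ : Measure (RN N)} {F G : RN N → RN N}
    (hF : MemLp F 2 μ) (hG : MemLp G 2 μ) : Integrable (fun x => (inner ℝ (F x) (G x) : ℝ)) μ := by
  refine (L2.integrable_inner (𝕜 := ℝ) (hF.toLp F) (hG.toLp G)).congr ?_
  filter_upwards [hF.coeFn_toLp, hG.coeFn_toLp] with x h1 h2
  rw [h1, h2]

theorem locallyIntegrable_of_memLp_compact {N : ℕ} {F : Type*} [NormedAddCommGroup F]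
    {v : RN N → F} (h : ∀ C : Set (RN N), IsCompact C → MemLp v 2 (vol C)) :
    LocallyIntegrable v volume := by
  rw [locallyIntegrable_iff]
  intro C hC
  have : IsFiniteMeasure (vol C) := ⟨by simpa using hC.measure_lt_top⟩
  exact (h C hC).integrable (by norm_num)

/-- Equivalence to `M` yields correctors on `ω`. -/
theorem IsEquivalentTo.exists_isCorrector {N : ℕ} {ω : Set (RN N)} (hω : IsOpen ω)
    (hωb : Bornology.IsBounded ω) (hω_null : volume (frontier ω) = 0) {α β : ℝ}
    {A : RN N → Mat N} (hA : IsCoeff α β ω A) {M : Mat N} (hAM : IsEquivalentTo ω A M) (l : RN N) :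
    ∃ (r : RN N → ℝ) (R g : RN N → RN N), IsCorrector ω A M l r R g := by
  obtain ⟨w, G, hw, hdiv, hbd⟩ := hAM l
  obtain ⟨ρ, hρ⟩ := hωb.subset_closedBall 0
  have hC : IsCompact (Metric.closedBall (0 : RN N) ρ) := isCompact_closedBall _ _
  have : IsFiniteMeasure (vol (Metric.closedBall (0 : RN N) ρ)) :=
    ⟨by simpa using hC.measure_lt_top⟩
  have hwl := locallyIntegrable_of_memLp_compact hw.memLp
  have hGl := locallyIntegrable_of_memLp_compact hw.memLp_grad
  have hlin : Continuous fun x : RN N => (inner ℝ l x : ℝ) := by fun_prop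
  let r : RN N → ℝ := fun x => w x - inner ℝ l x
  let R : RN N → RN N := fun x => G x - l
  let m : RN N := Matrix.toEuclideanLin M l
  let g : RN N → RN N := ω.indicator fun x => flux A G x - m
  have hr0 : ∀ᵐ x, x ∉ ω → r x = 0 := by
    filter_upwards [(ae_restrict_iff' hω.measurableSet.compl).1 hbd] with x hx hxω
    simp only [r, hx hxω, sub_self]
  have hweak : ∀ φ : RN N → ℝ, IsTest univ φ → ∫ x, r x • gradient φ x = - ∫ x, φ x • R x := by
    intro φ hφ
    simp only [r, R, sub_smul, smul_sub]
    rw [integral_sub (hwl.smul_gradient hφ) (hlin.locallyIntegrable.smul_gradient hφ),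
      integral_sub (hGl.smul_test hφ) (locallyIntegrable_const l |>.smul_test hφ),
      hw.weak_grad φ hφ, hφ.integral_inner_smul_gradient]
    abel
  have hRl : LocallyIntegrable R volume := hGl.sub (locallyIntegrable_const l)
  -- Test functions supported off `closure ω` see only `r = 0`. The frontier is not reached this way
  -- and is discarded next as a null set.
  have hR0' : ∀ᵐ x, x ∈ (closure ω)ᶜ → R x = 0 := by
    refine isClosed_closure.isOpen_compl.ae_eq_zero_of_integral_contDiff_smul_eq_zero
      (hRl.locallyIntegrableOn _) fun φ h1 h2 h3 => ?_
    have hφ : IsTest (closure ω)ᶜ φ := ⟨h1, h2, h3⟩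
    rw [← neg_eq_zero, ← hweak φ (hφ.mono (subset_univ _))]
    refine integral_eq_zero_of_ae ?_
    filter_upwards [hr0] with x hx
    by_cases hxω : x ∈ ω
    · rw [hφ.gradient_eq_zero (fun h => h (subset_closure hxω)), smul_zero, Pi.zero_apply]
    · rw [hx hxω, zero_smul, Pi.zero_apply]
  have hR0 : ∀ᵐ x, x ∉ ω → R x = 0 := by
    have hfr : ∀ᵐ x, x ∉ frontier ω := measure_eq_zero_iff_ae_notMem.1 hω_null
    filter_upwards [hR0', hfr] with x h1 h2 hxω
    refine h1 fun h => h2 ?_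
    rw [hω.frontier_eq]
    exact ⟨h, hxω⟩
  have hGω : MemLp G 2 (vol ω) :=
    (hw.memLp_grad _ hC).mono_measure (Measure.restrict_mono hρ le_rfl)
  have hfin : IsFiniteMeasure (vol ω) := ⟨by simpa using hωb.measure_lt_top⟩
  have hg : MemLp g 2 volume := by
    refine (memLp_indicator_iff_restrict hω.measurableSet).2 ?_
    exact (hA.memLp_flux hGω).sub (memLp_const m)
  -- Off `ω` one has `G = l` and the matrix is `M`, so the full flux is `g` plus a constant; as
  -- constants are divergence free, so is `g`.
  have hgae : ∀ᵐ x, flux (extendBy ω A M) G x = g x + m := by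
    filter_upwards [hR0] with x hx
    by_cases hxω : x ∈ ω
    · simp [flux, extendBy, hxω, g]
    · have : G x = l := sub_eq_zero.1 (hx hxω)
      simp [flux, extendBy, hxω, g, this, m]
  refine ⟨r, R, g, ⟨?_, ?_, hweak⟩, hg, hr0, hR0, ?_, ?_, ?_⟩
  · refine MemLp.of_ae_zero hC.measurableSet ?_
      (hr0.mono fun x hx hxC => hx fun h => hxC (hρ h))
    obtain ⟨b, hb⟩ := hC.exists_bound_of_continuousOn hlin.continuousOn
    exact (hw.memLp _ hC).sub (MemLp.of_bound hlin.aestronglyMeasurable b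
      ((ae_restrict_mem hC.measurableSet).mono hb))
  · refine MemLp.of_ae_zero hC.measurableSet ?_
      (hR0.mono fun x hx hxC => hx fun h => hxC (hρ h))
    exact (hw.memLp_grad _ hC).sub (memLp_const l)
  · exact Eventually.of_forall fun x hx => indicator_of_notMem hx _
  · refine Eventually.of_forall fun x hx => ?_
    simp only [R, g, indicator_of_mem hx, flux, add_sub_cancel, m]
  · intro ψ hψ
    have i1 : Integrable fun x => (inner ℝ (g x) (gradient ψ x) : ℝ) :=
      integrable_inner_of_memLp hg (hψ.continuous_gradient.memLp_of_hasCompactSupport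
        hψ.hasCompactSupport_gradient)
    have i0 : Integrable (gradient ψ) :=
      hψ.continuous_gradient.integrable_of_hasCompactSupport hψ.hasCompactSupport_gradient
    have h1 := hdiv ψ hψ
    have h2 : ∫ x, inner ℝ (flux (extendBy ω A M) G x) (gradient ψ x)
        = ∫ x, (inner ℝ (g x) (gradient ψ x) + inner ℝ m (gradient ψ x)) := by
      refine integral_congr_ae ?_
      filter_upwards [hgae] with x hx
      rw [hx, inner_add_left]
    rw [h2, integral_add i1 (i0.const_inner m), integral_inner i0, hψ.integral_gradient,
      inner_zero_right, add_zero] at h1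
    exact h1

/-! ### The contribution of one cell. -/

/-- A divergence free field is orthogonal to the gradients of `H^1_0` functions. -/
theorem integral_inner_grad_eq_zero {N : ℕ} {Ω : Set (RN N)} {g : RN N → RN N}
    (hg : MemLp g 2 volume)
    (hdiv : ∀ ψ : RN N → ℝ, IsTest univ ψ → ∫ x, inner ℝ (g x) (gradient ψ x) = 0)
    (u : H10 Ω) : ∫ x in Ω, inner ℝ (g x) (H10.grad u x) = 0 := by
  have hgΩ := hg.restrict Ω
  have hclosed : IsClosed {v : GraphSpace Ω | inner ℝ (hgΩ.toLp g) v.snd = 0} :=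
    isClosed_eq (by fun_prop) continuous_const
  have hsub : (testPairs Ω : Set (GraphSpace Ω)) ⊆
      {v : GraphSpace Ω | inner ℝ (hgΩ.toLp g) v.snd = 0} := by
    rintro v ⟨φ, hφ, -, h2⟩
    change inner ℝ (hgΩ.toLp g) v.snd = 0
    rw [← hdiv φ (hφ.mono (subset_univ _)), L2.inner_def,
      ← setIntegral_eq_integral_of_forall_compl_eq_zero (μ := volume) (s := Ω)
      (fun x hx => by rw [hφ.gradient_eq_zero hx, inner_zero_right])]
    refine integral_congr_ae ?_
    filter_upwards [h2, hgΩ.coeFn_toLp] with x h3 h4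
    rw [h3, h4]
  have h : inner ℝ (hgΩ.toLp g) (H10.grad u) = 0 := closure_minimal hsub hclosed u.2
  rw [← h, L2.inner_def]
  refine integral_congr_ae ?_
  filter_upwards [hgΩ.coeFn_toLp] with x h4
  rw [h4]

/-- Every term on the right is small on a small cell: it contains either `r` or the oscillation of
`φ`. The number `t` is free because `g` is orthogonal to `∇u`. All corrector fields vanish off `c`,
so the right-hand integral may run over `Ω`. -/
theorem IsCorrector.setIntegral_eq {N : ℕ} {c Ω : Set (RN N)} {B A : RN N → Mat N} {M : Mat N}
    {l : RN N} {r : RN N → ℝ} {R g : RN N → RN N} (h : IsCorrector c B M l r R g)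
    (hΩ : IsOpen Ω) (hc : MeasurableSet c) {α β : ℝ} (hA : IsCoeff α β Ω A)
    (hAB : ∀ x ∈ c, A x = B x) {f : Lp ℝ 2 (vol Ω)} {u : H10 Ω} (hu : IsDirichletSolution A f u)
    {φ : RN N → ℝ} (hφ : IsTest Ω φ) (t : ℝ) :
    ∫ x in Ω ∩ c, φ x * (inner ℝ (flux A (H10.grad u) x) l -
        inner ℝ (Matrix.toEuclideanLin M l) (H10.grad u x))
      = ∫ x in Ω, ((φ x - t) * inner ℝ (g x) (H10.grad u x) - f x * (φ x * r x) +
        r x * inner ℝ (flux A (H10.grad u) x) (gradient φ x)) := by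
  have hσ := hA.memLp_flux (Lp.memLp (H10.grad u))
  have hgΩ := h.memLp.restrict Ω
  have hrΩ := h.isWeakH1.memLp.restrict Ω
  have hRΩ := h.isWeakH1.memLp_grad.restrict Ω
  have hφt : MemLp φ ⊤ (vol Ω) := hφ.memLp_top.restrict Ω
  have hgt : MemLp (gradient φ) ⊤ (vol Ω) := hφ.memLp_top_gradient.restrict Ω
  have hφr : MemLp (fun x => φ x * r x) 2 (vol Ω) := hrΩ.mul (p := ⊤) hφt
  have i1 : Integrable (fun x => (inner ℝ (g x) (H10.grad u x) : ℝ)) (vol Ω) :=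
    integrable_inner_of_memLp hgΩ (Lp.memLp _)
  have i1' : Integrable (fun x => φ x * (inner ℝ (g x) (H10.grad u x) : ℝ)) (vol Ω) := by
    have := integrable_inner_of_memLp (hgΩ.smul (p := ⊤) (r := 2) hφt) (Lp.memLp (H10.grad u))
    exact this.congr (Eventually.of_forall fun x => by simp [real_inner_smul_left])
  have i2 : Integrable (fun x => φ x * (inner ℝ (flux A (H10.grad u) x) (R x) : ℝ)) (vol Ω) := by
    have := integrable_inner_of_memLp hσ (hRΩ.smul (p := ⊤) (r := 2) hφt)
    exact this.congr (Eventually.of_forall fun x => by simp [real_inner_smul_right])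
  have i3 : Integrable (fun x => r x * (inner ℝ (flux A (H10.grad u) x) (gradient φ x) : ℝ))
      (vol Ω) := by
    have := integrable_inner_of_memLp hσ (hgt.smul (p := 2) (r := 2) hrΩ)
    exact this.congr (Eventually.of_forall fun x => by simp [real_inner_smul_right])
  have i4 : Integrable (fun x => f x * (φ x * r x)) (vol Ω) := (Lp.memLp f).integrable_mul hφr
  have e1 : ∫ x in Ω ∩ c, φ x * (inner ℝ (flux A (H10.grad u) x) l -
        inner ℝ (Matrix.toEuclideanLin M l) (H10.grad u x))
      = ∫ x in Ω, (φ x * inner ℝ (g x) (H10.grad u x) -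
        φ x * inner ℝ (flux A (H10.grad u) x) (R x)) := by
    rw [← setIntegral_indicator hc]
    refine integral_congr_ae ?_
    filter_upwards [hA.symm, ae_restrict_of_ae h.grad_zero, ae_restrict_of_ae h.zero,
      ae_restrict_of_ae h.flux_eq] with x h1 h2 h3 h4
    by_cases hx : x ∈ c
    -- Symmetry moves `A` onto the corrector: `A∇u·(l + R) = ∇u·(Ml + g)`.
    · have h5 := inner_toEuclideanLin_comm h1 (H10.grad u x) (l + R x)
      rw [inner_add_right, hAB x hx, h4 hx, inner_add_right, real_inner_comm _ (H10.grad u x),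
        real_inner_comm _ (H10.grad u x), ← hAB x hx] at h5
      rw [indicator_of_mem hx]
      simp only [flux]
      linear_combination φ x * h5
    · rw [indicator_of_notMem hx, h2 hx, h3 hx]
      simp
  -- The function `φ r` is admissible even when the cell sticks out of `Ω`, because `φ` has compact
  -- support in `Ω`.
  obtain ⟨v, hv1, hv2⟩ := h.isWeakH1.exists_H10_mul_test hΩ hφ
  have e2 : ∫ x in Ω, φ x * inner ℝ (flux A (H10.grad u) x) (R x)
      = (∫ x in Ω, f x * (φ x * r x)) -
        ∫ x in Ω, r x * inner ℝ (flux A (H10.grad u) x) (gradient φ x) := by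
    have h1 := hu v
    have h2 : ∫ x in Ω, inner ℝ (flux A (H10.grad u) x) (H10.grad v x)
        = ∫ x in Ω, (r x * inner ℝ (flux A (H10.grad u) x) (gradient φ x) +
          φ x * inner ℝ (flux A (H10.grad u) x) (R x)) := by
      refine integral_congr_ae ?_
      filter_upwards [hv2] with x hx
      rw [hx, inner_add_right, real_inner_smul_right, real_inner_smul_right]
    have h3 : ∫ x in Ω, f x * H10.fn v x = ∫ x in Ω, f x * (φ x * r x) := by
      refine integral_congr_ae ?_
      filter_upwards [hv1] with x hx
      rw [hx]
    rw [h2, h3, integral_add i3 i2] at h1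
    linarith
  have e3 := integral_inner_grad_eq_zero h.memLp h.div_free u
  have i5 : Integrable (fun x => φ x * (inner ℝ (g x) (H10.grad u x) : ℝ) -
      t * inner ℝ (g x) (H10.grad u x)) (vol Ω) := i1'.sub (i1.const_mul t)
  have i6 : Integrable (fun x => φ x * (inner ℝ (g x) (H10.grad u x) : ℝ) -
      t * inner ℝ (g x) (H10.grad u x) - f x * (φ x * r x)) (vol Ω) := i5.sub i4
  simp only [sub_mul]
  rw [e1, integral_sub i1' i2, e2, integral_add i6 i3, integral_sub i5 i4, integral_sub i1' (i1.const_mul t),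
    integral_const_mul, e3]
  ring

/-- The contribution of one cell to `∫ φ (A∇u·l - Ml·∇u)`. -/
theorem IsCorrector.abs_setIntegral_le {N : ℕ} {c Ω : Set (RN N)} {B A : RN N → Mat N} {M : Mat N}
    {l : RN N} {r : RN N → ℝ} {R g : RN N → RN N} (h : IsCorrector c B M l r R g)
    (hΩ : IsOpen Ω) (hc : MeasurableSet c) {α β : ℝ} (hA : IsCoeff α β Ω A)
    (hAB : ∀ x ∈ c, A x = B x) {f : Lp ℝ 2 (vol Ω)} {u : H10 Ω} (hu : IsDirichletSolution A f u)
    {φ : RN N → ℝ} (hφ : IsTest Ω φ) {L D ε t : ℝ} (hε : 0 < ε) (hD : 0 ≤ D)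
    (hφL : ∀ x, |φ x| ≤ L)
    (hgL : ∀ x, ‖gradient φ x‖ ≤ L) (hosc : ∀ x ∈ c, |φ x - t| ≤ L * (ε * D)) :
    |∫ x in Ω ∩ c, φ x * (inner ℝ (flux A (H10.grad u) x) l -
        inner ℝ (Matrix.toEuclideanLin M l) (H10.grad u x))|
      ≤ L * ε * (∫ x in Ω ∩ c, (f x ^ 2 + ‖flux A (H10.grad u) x‖ ^ 2 + D * ‖H10.grad u x‖ ^ 2)) +
        L / ε * (∫ x, r x ^ 2) + L * ε * D * ∫ x, ‖g x‖ ^ 2 := by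
  have hL : 0 ≤ L := (norm_nonneg _).trans (hgL 0)
  have hσ := hA.memLp_flux (Lp.memLp (H10.grad u))
  have j1 : Integrable (fun x => f x ^ 2 + ‖flux A (H10.grad u) x‖ ^ 2 + D * ‖H10.grad u x‖ ^ 2)
      (vol Ω) :=
    ((Lp.memLp f).integrable_sq.add (hσ.integrable_norm_pow (p := 2) (by norm_num))).add
      (((Lp.memLp (H10.grad u)).integrable_norm_pow (p := 2) (by norm_num)).const_mul D)
  have j1' := (j1.indicator hc).const_mul (L * ε)
  have j2 : Integrable (fun x => r x ^ 2) volume := h.isWeakH1.memLp.integrable_sq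
  have j3 : Integrable (fun x => ‖g x‖ ^ 2) volume :=
    h.memLp.integrable_norm_pow (p := 2) (by norm_num)
  have j2' := (j2.restrict (s := Ω)).const_mul (L / ε)
  have j3' := (j3.restrict (s := Ω)).const_mul (L * ε * D)
  rw [h.setIntegral_eq hΩ hc hA hAB hu hφ t, ← Real.norm_eq_abs]
  refine (norm_integral_le_of_norm_le ((j1'.add j2').add j3') ?_).trans ?_
  · filter_upwards [ae_restrict_of_ae h.fn_zero, ae_restrict_of_ae h.zero] with x h1 h2
    rw [Real.norm_eq_abs]
    simp only [Pi.add_apply]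
    by_cases hx : x ∈ c
    · rw [indicator_of_mem hx]
      have k1 : |(φ x - t) * inner ℝ (g x) (H10.grad u x)| ≤
          L * (ε * D) * (‖g x‖ * ‖H10.grad u x‖) := by
        rw [abs_mul]
        exact mul_le_mul (hosc x hx) (abs_real_inner_le_norm _ _) (abs_nonneg _) (by positivity)
      have k2 : |f x * (φ x * r x)| ≤ L * (|f x| * |r x|) := by
        rw [abs_mul, abs_mul]
        nlinarith [mul_le_mul_of_nonneg_right (hφL x)
          (mul_nonneg (abs_nonneg (f x)) (abs_nonneg (r x)))]
      have k3 : |r x * inner ℝ (flux A (H10.grad u) x) (gradient φ x)| ≤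
          L * (‖flux A (H10.grad u) x‖ * |r x|) := by
        rw [abs_mul]
        have := (abs_real_inner_le_norm (flux A (H10.grad u) x) (gradient φ x)).trans
          (mul_le_mul_of_nonneg_left (hgL x) (norm_nonneg _))
        nlinarith [mul_le_mul_of_nonneg_left this (abs_nonneg (r x))]
      -- The weight `ε` matches the size of a rescaled `r`: both `ε a²` and `r²/ε` are then of order
      -- `ε`.
      have amgm : ∀ a b : ℝ, a * b ≤ ε / 2 * a ^ 2 + 1 / (2 * ε) * b ^ 2 := fun a b => by
        have h3 : ε / 2 * a ^ 2 + 1 / (2 * ε) * b ^ 2 - a * b = (ε * a - b) ^ 2 / (2 * ε) := by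
          field_simp
          ring
        have : 0 ≤ (ε * a - b) ^ 2 / (2 * ε) := by positivity
        linarith
      have k2' := mul_le_mul_of_nonneg_left (amgm |f x| |r x|) hL
      have k3' := mul_le_mul_of_nonneg_left (amgm ‖flux A (H10.grad u) x‖ |r x|) hL
      have k1' : L * (ε * D) * (‖g x‖ * ‖H10.grad u x‖) ≤
          L * (ε * D) * (‖g x‖ ^ 2 + ‖H10.grad u x‖ ^ 2) := by
        refine mul_le_mul_of_nonneg_left ?_ (by positivity)
        nlinarith [sq_nonneg (‖g x‖ - ‖H10.grad u x‖), sq_nonneg ‖g x‖, sq_nonneg ‖H10.grad u x‖]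
      rw [sq_abs, sq_abs] at k2'
      rw [sq_abs] at k3'
      have k4 : L * (1 / (2 * ε) * r x ^ 2) = L / ε * r x ^ 2 / 2 := by
        field_simp
      have k5 := abs_add_le ((φ x - t) * inner ℝ (g x) (H10.grad u x) - f x * (φ x * r x))
        (r x * inner ℝ (flux A (H10.grad u) x) (gradient φ x))
      have k6 := abs_sub ((φ x - t) * inner ℝ (g x) (H10.grad u x)) (f x * (φ x * r x))
      have k7 : 0 ≤ L * ε * (f x ^ 2 + ‖flux A (H10.grad u) x‖ ^ 2) := by positivity
      linarith
    · rw [indicator_of_notMem hx, h1 hx, h2 hx]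
      simp
  · rw [integral_add' (j1'.add j2') j3', integral_add' j1' j2', integral_const_mul,
      integral_const_mul, integral_const_mul, setIntegral_indicator hc]
    have k1 : ∫ x in Ω, r x ^ 2 ≤ ∫ x, r x ^ 2 :=
      setIntegral_le_integral j2 (Eventually.of_forall fun x => sq_nonneg _)
    have k2 : ∫ x in Ω, ‖g x‖ ^ 2 ≤ ∫ x, ‖g x‖ ^ 2 :=
      setIntegral_le_integral j3 (Eventually.of_forall fun x => sq_nonneg _)
    gcongr

/-! ### The Hashin–Shtrikman coefficients and summation over the cells. -/

theorem hsCoeff_of_mem {N : ℕ} {ω : Set (RN N)} {A : RN N → Mat N} {K : Type*} {ε : K → ℝ}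
    {y : K → RN N} (hdisj : ∀ p q, p ≠ q → Disjoint (cell ω (ε p) (y p)) (cell ω (ε q) (y q)))
    {p : K} {x : RN N} (hx : x ∈ cell ω (ε p) (y p)) :
    hsCoeff ω A ε y x = A (rescale (ε p) (y p) x) := by
  have h : ∃ p, x ∈ cell ω (ε p) (y p) := ⟨p, hx⟩
  have hp : h.choose = p := by
    by_contra hne
    exact disjoint_left.1 (hdisj _ _ hne) h.choose_spec hx
  rw [hsCoeff, dif_pos h, hp]
  rfl

/-- Rescaling pulls null sets back to null sets, and countably many cells fill `Ω` up to a null set;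
so the pointwise properties transfer with the same `α` and `β`. -/
theorem isCoeff_hsCoeff {N : ℕ} {Ω ω : Set (RN N)} (hω : IsOpen ω) {α β : ℝ}
    {A : RN N → Mat N} (hA : IsCoeff α β ω A) {K : Type*} [Countable K] {ε : K → ℝ}
    {y : K → RN N} (hpos : ∀ p, 0 < ε p)
    (hdisj : ∀ p q, p ≠ q → Disjoint (cell ω (ε p) (y p)) (cell ω (ε q) (y q)))
    (hcov : volume (Ω \ ⋃ p, cell ω (ε p) (y p)) = 0) :
    IsCoeff α β Ω (hsCoeff ω A ε y) := by
  have hle : vol Ω ≤ vol (⋃ p, cell ω (ε p) (y p)) :=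
    Measure.restrict_mono_ae (ae_le_set.2 hcov)
  have hae : ∀ P : Mat N → Prop, (∀ᵐ x ∂(vol ω), P (A x)) →
      ∀ᵐ x ∂(vol Ω), P (hsCoeff ω A ε y x) := by
    intro P hP
    refine Eventually.filter_mono (ae_mono hle) ?_
    rw [ae_restrict_iUnion_iff]
    intro p
    rw [ae_restrict_iff' (isOpen_cell hω (hpos p) _).measurableSet]
    filter_upwards [(quasiMeasurePreserving_rescale (hpos p) (y p)).ae
      ((ae_restrict_iff' hω.measurableSet).1 hP)] with x hx hxc
    rw [hsCoeff_of_mem hdisj hxc]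
    exact hx ((mem_cell_iff (hpos p)).1 hxc)
  refine ⟨fun i j => ?_, hae (fun B => ∀ i j, B i j = B j i) hA.symm,
    hae (fun B => ∀ ξ : RN N, α * ‖ξ‖ ^ 2 ≤ inner ℝ (Matrix.toEuclideanLin B ξ) ξ) hA.coercive,
    hae (fun B => ∀ ξ : RN N, ‖Matrix.toEuclideanLin B ξ‖ ≤ β * ‖ξ‖) hA.bounded⟩
  refine AEMeasurable.mono_measure ?_ hle
  rw [aemeasurable_iUnion_iff]
  intro p
  have hm : MapsTo (rescale (ε p) (y p)) (cell ω (ε p) (y p)) ω :=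
    fun x hx => (mem_cell_iff (hpos p)).1 hx
  have h1 := (hA.aemeasurable i j).comp_quasiMeasurePreserving
    ((quasiMeasurePreserving_rescale (hpos p) (y p)).restrict hm)
  refine h1.congr ?_
  filter_upwards [ae_restrict_mem (isOpen_cell hω (hpos p) (y p)).measurableSet] with x hx
  rw [hsCoeff_of_mem hdisj hx]
  rfl

theorem IsTest.exists_bound {N : ℕ} {U : Set (RN N)} {φ : RN N → ℝ} (hφ : IsTest U φ) :
    ∃ L : ℝ, (∀ x, |φ x| ≤ L) ∧ ∀ x, ‖gradient φ x‖ ≤ L := by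
  obtain ⟨a, ha⟩ := hφ.compact.exists_bound_of_continuous hφ.continuous
  obtain ⟨b, hb⟩ := hφ.hasCompactSupport_gradient.exists_bound_of_continuous
    hφ.continuous_gradient
  exact ⟨max a b, fun x => (ha x).trans (le_max_left _ _), fun x => (hb x).trans (le_max_right _ _)⟩

theorem IsTest.abs_sub_le {N : ℕ} {U : Set (RN N)} {φ : RN N → ℝ} (hφ : IsTest U φ) {L : ℝ}
    (hL : ∀ x, ‖gradient φ x‖ ≤ L) (x z : RN N) : |φ x - φ z| ≤ L * ‖x - z‖ := by
  refine convex_univ.norm_image_sub_le_of_norm_fderiv_le (𝕜 := ℝ)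
    (fun x _ => hφ.differentiableAt x) (fun x _ => ?_) (mem_univ z) (mem_univ x)
  rw [← toDual_gradient, LinearIsometryEquiv.norm_map]
  exact hL x

/-- A cell costs at most `L ε_p (∫ H + C ε_p^N)`, the integral being over its part in `Ω`. As
`ε_p^N` is its volume divided by that of `ω`, disjointness bounds the sum by `s` times an integral
over `Ω` and the volume of a fixed ball. -/
theorem abs_integral_le_of_covering {N : ℕ} {Ω ω : Set (RN N)} (hΩ : IsOpen Ω) (hω : IsOpen ω)
    (hne : ω.Nonempty) {ρ ρ' : ℝ} (hρ : ∀ z ∈ ω, ‖z‖ ≤ ρ) (hρ' : ∀ x ∈ Ω, ‖x‖ ≤ ρ')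
    {A : RN N → Mat N} {M : Mat N} {l : RN N} {r : RN N → ℝ} {R g : RN N → RN N}
    (h : IsCorrector ω A M l r R g) {K : Type*} [Countable K] {ε : K → ℝ} {y : K → RN N}
    (hpos : ∀ p, 0 < ε p)
    (hdisj : ∀ p q, p ≠ q → Disjoint (cell ω (ε p) (y p)) (cell ω (ε q) (y q)))
    (hcov : volume (Ω \ ⋃ p, cell ω (ε p) (y p)) = 0) {s : ℝ} (hs : ∀ p, ε p ≤ s) (hs0 : 0 ≤ s)
    (hs1 : s ≤ 1) {α β : ℝ} (hA : IsCoeff α β Ω (hsCoeff ω A ε y)) {f : Lp ℝ 2 (vol Ω)} {u : H10 Ω}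
    (hu : IsDirichletSolution (hsCoeff ω A ε y) f u) {φ : RN N → ℝ} (hφ : IsTest Ω φ) {L : ℝ}
    (hφL : ∀ x, |φ x| ≤ L) (hgL : ∀ x, ‖gradient φ x‖ ≤ L) :
    |∫ x in Ω, φ x * (inner ℝ (flux (hsCoeff ω A ε y) (H10.grad u) x) l -
        inner ℝ (Matrix.toEuclideanLin M l) (H10.grad u x))|
      ≤ L * s * (‖f‖ ^ 2 + ‖hA.op (H10.grad u)‖ ^ 2 + ρ * ‖H10.grad u‖ ^ 2 +
        ((∫ x, r x ^ 2) + ρ * ∫ x, ‖g x‖ ^ 2) / volume.real ω *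
          volume.real (Metric.closedBall (0 : RN N) (ρ' + 2 * ρ))) := by
  have hL : 0 ≤ L := (norm_nonneg _).trans (hgL 0)
  have hρ0 : 0 ≤ ρ := (norm_nonneg _).trans (hρ _ hne.some_mem)
  set F : RN N → ℝ := fun x => φ x * (inner ℝ (flux (hsCoeff ω A ε y) (H10.grad u) x) l -
        inner ℝ (Matrix.toEuclideanLin M l) (H10.grad u x)) with hF
  set H : RN N → ℝ := fun x => f x ^ 2 + ‖flux (hsCoeff ω A ε y) (H10.grad u) x‖ ^ 2 +
    ρ * ‖H10.grad u x‖ ^ 2 with hH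
  set C : ℝ := (∫ x, r x ^ 2) + ρ * ∫ x, ‖g x‖ ^ 2 with hC
  set B := Metric.closedBall (0 : RN N) (ρ' + 2 * ρ) with hB
  have hC0 : 0 ≤ C := add_nonneg (integral_nonneg fun _ => sq_nonneg _)
    (mul_nonneg hρ0 (integral_nonneg fun _ => sq_nonneg _))
  have hωfin : volume ω ≠ ⊤ :=
    (Bornology.IsBounded.measure_lt_top (isBounded_iff_forall_norm_le.2 ⟨ρ, hρ⟩)).ne
  have hωpos : 0 < volume.real ω := ENNReal.toReal_pos (hω.measure_pos _ hne).ne' hωfin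
  have hσ := hA.memLp_flux (Lp.memLp (H10.grad u))
  have hcm : ∀ p, MeasurableSet (cell ω (ε p) (y p)) := fun p =>
    (isOpen_cell hω (hpos p) _).measurableSet
  have hHi : IntegrableOn H Ω :=
    ((Lp.memLp f).integrable_sq.add (hσ.integrable_norm_pow (p := 2) (by norm_num))).add
      (((Lp.memLp (H10.grad u)).integrable_norm_pow (p := 2) (by norm_num)).const_mul ρ)
  have hH0 : ∀ x, 0 ≤ H x := fun x => by positivity
  have hFi : IntegrableOn F Ω := by
    have i1 := integrable_inner_of_memLp hσ (hφ.memLp_smul_const l)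
    have i2 := integrable_inner_of_memLp (hφ.memLp_smul_const (Matrix.toEuclideanLin M l))
      (Lp.memLp (H10.grad u))
    refine (i1.sub i2).congr (Eventually.of_forall fun x => ?_)
    simp only [hF, Pi.sub_apply, real_inner_smul_left, real_inner_smul_right]
    ring
  -- The constant on `B` encodes `C ε_p^N` as an integral over the cell, so that countable
  -- additivity performs the summation.
  let Φ : RN N → ℝ := fun x => Ω.indicator H x + B.indicator (fun _ => C / volume.real ω) x
  have hBi : Integrable (B.indicator fun _ => C / volume.real ω) :=
    (integrable_indicator_iff measurableSet_closedBall).2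
      (integrableOn_const (Metric.isBounded_closedBall.measure_lt_top.ne))
  have hΩi : Integrable (Ω.indicator H) := (integrable_indicator_iff hΩ.measurableSet).2 hHi
  have hΦi : Integrable Φ := hΩi.add hBi
  have hΦ0 : ∀ x, 0 ≤ Φ x := fun x => add_nonneg (indicator_nonneg (fun x _ => hH0 x) x)
    (indicator_nonneg (fun _ _ => by positivity) x)
  have hdisj' : Pairwise (Function.onFun Disjoint fun p => cell ω (ε p) (y p)) :=
    fun p q hpq => hdisj p q hpq
  have hcell : ∀ p, |∫ x in Ω ∩ cell ω (ε p) (y p), F x| ≤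
      L * s * ∫ x in cell ω (ε p) (y p), Φ x := by
    intro p
    have hcorr := h.rescale (hpos p) (y p)
    rcases (Ω ∩ cell ω (ε p) (y p)).eq_empty_or_nonempty with he | ⟨x₀, hx₀Ω, hx₀⟩
    · rw [he, setIntegral_empty, abs_zero]
      exact mul_nonneg (by positivity) (integral_nonneg hΦ0)
    -- A cell that meets `Ω` has diameter at most `2ρ`, since its scale is at most `1`.
    have hsub : cell ω (ε p) (y p) ⊆ B := by
      obtain ⟨z₀, hz₀, rfl⟩ := hx₀
      rintro _ ⟨z, hz, rfl⟩
      rw [hB, mem_closedBall_zero_iff]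
      have e1 : ε p • z + y p = (ε p • z₀ + y p) + ε p • (z - z₀) := by module
      have e2 : ‖ε p • (z - z₀)‖ ≤ 1 * (ρ + ρ) := by
        rw [norm_smul, Real.norm_of_nonneg (hpos p).le]
        exact mul_le_mul ((hs p).trans hs1) ((norm_sub_le _ _).trans (add_le_add (hρ _ hz)
          (hρ _ hz₀))) (norm_nonneg _) zero_le_one
      change ‖ε p • z + y p‖ ≤ _
      rw [e1]
      refine (norm_add_le _ _).trans ?_
      have := hρ' _ hx₀Ω
      dsimp only at this
      linarith
    -- The reference value is taken at `y p`, which need not lie in the cell but is within `ε p * ρ`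
    -- of its points.
    have hosc : ∀ x ∈ cell ω (ε p) (y p), |φ x - φ (y p)| ≤ L * (ε p * ρ) := by
      rintro _ ⟨z, hz, rfl⟩
      refine (hφ.abs_sub_le hgL _ _).trans (mul_le_mul_of_nonneg_left ?_ hL)
      simp only [add_sub_cancel_right, norm_smul, Real.norm_of_nonneg (hpos p).le]
      exact mul_le_mul_of_nonneg_left (hρ _ hz) (hpos p).le
    have hest := hcorr.abs_setIntegral_le hΩ (hcm p) hA (fun x hx => hsCoeff_of_mem hdisj hx) hu hφ
      (hpos p) hρ0 hφL hgL hosc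
    refine hest.trans ?_
    have e1 : ∫ x, (ε p * r (rescale (ε p) (y p) x)) ^ 2 = ε p ^ 2 * (ε p ^ N * ∫ x, r x ^ 2) := by
      simp only [mul_pow]
      rw [integral_const_mul, integral_comp_rescale (hpos p) (y p) fun z => r z ^ 2, smul_eq_mul]
    have e2 : ∫ x, ‖g (rescale (ε p) (y p) x)‖ ^ 2 = ε p ^ N * ∫ x, ‖g x‖ ^ 2 := by
      rw [integral_comp_rescale (hpos p) (y p) fun z => ‖g z‖ ^ 2, smul_eq_mul]
    have e3 : ∫ x in cell ω (ε p) (y p), Φ x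
        = (∫ x in Ω ∩ cell ω (ε p) (y p), H x) + C * ε p ^ N := by
      have hv : volume.real (cell ω (ε p) (y p)) = ε p ^ N * volume.real ω := by
        rw [measureReal_def, volume_cell hω (hpos p), ENNReal.toReal_mul,
          ENNReal.toReal_ofReal (by have := hpos p; positivity), measureReal_def]
      rw [integral_add hΩi.integrableOn hBi.integrableOn, setIntegral_indicator hΩ.measurableSet,
        setIntegral_indicator measurableSet_closedBall, inter_eq_left.2 hsub, setIntegral_const, hv,
        inter_comm, smul_eq_mul]
      field_simp
    rw [e1, e2, e3]
    have e4 : L * ε p * (∫ x in Ω ∩ cell ω (ε p) (y p), H x) +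
        L / ε p * (ε p ^ 2 * (ε p ^ N * ∫ x, r x ^ 2)) +
        L * ε p * ρ * (ε p ^ N * ∫ x, ‖g x‖ ^ 2) =
        L * ε p * ((∫ x in Ω ∩ cell ω (ε p) (y p), H x) + C * ε p ^ N) := by
      have := (hpos p).ne'
      rw [hC]
      field_simp
      ring
    refine e4.le.trans ?_
    have hnn : 0 ≤ (∫ x in Ω ∩ cell ω (ε p) (y p), H x) + C * ε p ^ N :=
      add_nonneg (integral_nonneg hH0) (mul_nonneg hC0 (pow_nonneg (hpos p).le _))
    exact mul_le_mul_of_nonneg_right (mul_le_mul_of_nonneg_left (hs p) hL) hnn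
  have hΩU : ∫ x in Ω, F x = ∑' p, ∫ x in Ω ∩ cell ω (ε p) (y p), F x := by
    have hae : (Ω : Set (RN N)) =ᵐ[volume] ⋃ p, Ω ∩ cell ω (ε p) (y p) := by
      rw [← inter_iUnion]
      refine (ae_eq_set.2 ⟨?_, ?_⟩)
      · rw [sdiff_self_inter]
        exact hcov
      · rw [sdiff_eq_empty.2 inter_subset_left, measure_empty]
    rw [setIntegral_congr_set hae]
    refine integral_iUnion (fun p => hΩ.measurableSet.inter (hcm p)) ?_ ?_
    · exact fun p q hpq => (hdisj p q hpq).mono inter_subset_right inter_subset_right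
    · exact hFi.mono_set (iUnion_subset fun p => inter_subset_left)
  have hsum := hasSum_integral_iUnion hcm hdisj' (hΦi.integrableOn (s := ⋃ p, cell ω (ε p) (y p)))
  have hsum' := hsum.mul_left (L * s)
  rw [hΩU, ← Real.norm_eq_abs]
  refine (tsum_of_norm_bounded hsum' hcell).trans ?_
  refine mul_le_mul_of_nonneg_left ?_ (by positivity)
  refine (setIntegral_le_integral hΦi (Eventually.of_forall hΦ0)).trans (le_of_eq ?_)
  have e5 : ∫ x, Φ x = (∫ x in Ω, H x) + C / volume.real ω * volume.real B := by
    rw [integral_add hΩi hBi, integral_indicator hΩ.measurableSet,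
      integral_indicator measurableSet_closedBall, setIntegral_const, smul_eq_mul, mul_comm]
  have e6 : ∫ x in Ω, H x = ‖f‖ ^ 2 + ‖hA.op (H10.grad u)‖ ^ 2 + ρ * ‖H10.grad u‖ ^ 2 := by
    have e7 : ∫ x in Ω, ‖flux (hsCoeff ω A ε y) (H10.grad u) x‖ ^ 2
        = ∫ x in Ω, ‖hA.op (H10.grad u) x‖ ^ 2 := by
      refine integral_congr_ae ?_
      filter_upwards [hA.coeFn_op (H10.grad u)] with x hx
      rw [hx]
    rw [Lp_norm_sq_eq, Lp_norm_sq_eq, Lp_norm_sq_eq, ← e7]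
    simp only [Real.norm_eq_abs, sq_abs]
    have j1 := (Lp.memLp f).integrable_sq
    have j2 := hσ.integrable_norm_pow (p := 2) (by norm_num)
    have j3 := ((Lp.memLp (H10.grad u)).integrable_norm_pow (p := 2) (by norm_num)).const_mul ρ
    rw [hH, ← integral_const_mul, ← integral_add j1 j2]
    exact integral_add (j1.add j2) j3
  rw [e5, e6]

/-! ### Symmetry and coercivity of `M`. -/

theorem exists_cutoff {N : ℕ} {ω : Set (RN N)} (hωb : Bornology.IsBounded ω) :
    ∃ χ : RN N → ℝ, IsTest univ χ ∧ ∀ x ∈ ω, χ x = 1 ∧ gradient χ x = 0 := by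
  obtain ⟨ρ, hρ0, hρ⟩ := hωb.exists_pos_norm_le
  let b : ContDiffBump (0 : RN N) := ⟨ρ + 1, ρ + 2, by linarith, by linarith⟩
  refine ⟨b, ⟨b.contDiff, b.hasCompactSupport, subset_univ _⟩, fun x hx => ?_⟩
  have hball : x ∈ Metric.ball (0 : RN N) b.rIn := by
    rw [mem_ball_zero_iff]
    have := hρ x hx
    change ‖x‖ < ρ + 1
    linarith
  refine ⟨b.one_of_mem_closedBall (Metric.ball_subset_closedBall hball), ?_⟩
  have : (b : RN N → ℝ) =ᶠ[𝓝 x] fun _ => 1 := b.eventuallyEq_one_of_mem_ball hball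
  rw [this.gradient_eq, gradient_fun_const]

/-- Of the four terms in the expansion only the constant one survives: `R'` has mean zero, and `g`
is orthogonal to the gradients of `l'·x` and of `r'`. A cutoff equal to `1` on `ω` makes the
non-compactly supported test functions admissible. With `m = Ml` this is the energy identity behind
the symmetry of `M`. -/
theorem IsCorrector.setIntegral_inner {N : ℕ} {ω : Set (RN N)}
    (hωb : Bornology.IsBounded ω) {A : RN N → Mat N} {M : Mat N} {l l' : RN N} {r r' : RN N → ℝ}
    {R g R' g' : RN N → RN N} (h : IsCorrector ω A M l r R g) (h' : IsCorrector ω A M l' r' R' g')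
    (m : RN N) : ∫ x in ω, inner ℝ (m + g x) (l' + R' x) = volume.real ω * inner ℝ m l' := by
  obtain ⟨χ, hχ, hχω⟩ := exists_cutoff hωb
  have hfin : IsFiniteMeasure (vol ω) := ⟨by simpa using hωb.measure_lt_top⟩
  have hgω := h.memLp.restrict ω
  have hRω := h'.isWeakH1.memLp_grad.restrict ω
  have iR : Integrable R' (vol ω) := hRω.integrable (by norm_num)
  have ig : Integrable g (vol ω) := hgω.integrable (by norm_num)
  have z1 : ∫ x in ω, R' x = 0 := by
    rw [setIntegral_eq_integral_of_ae_compl_eq_zero h'.grad_zero]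
    have h1 := h'.isWeakH1.weak_grad χ hχ
    have h2 : ∫ x, r' x • gradient χ x = 0 := by
      refine integral_eq_zero_of_ae ?_
      filter_upwards [h'.fn_zero] with x hx
      by_cases hxω : x ∈ ω
      · rw [(hχω x hxω).2, smul_zero, Pi.zero_apply]
      · rw [hx hxω, zero_smul, Pi.zero_apply]
    have h3 : ∫ x, χ x • R' x = ∫ x, R' x := by
      refine integral_congr_ae ?_
      filter_upwards [h'.grad_zero] with x hx
      by_cases hxω : x ∈ ω
      · rw [(hχω x hxω).1, one_smul]
      · rw [hx hxω, smul_zero]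
    rw [h2, h3] at h1
    exact neg_eq_zero.1 h1.symm
  have z2 : ∫ x in ω, inner ℝ (g x) l' = 0 := by
    rw [setIntegral_eq_integral_of_ae_compl_eq_zero
      (h.zero.mono fun x hx hxω => by rw [hx hxω, inner_zero_left]),
      ← h.div_free _ (hχ.mul (contDiff_inner_const l'))]
    refine integral_congr_ae ?_
    filter_upwards [h.zero] with x hx
    by_cases hxω : x ∈ ω
    · rw [gradient_mul (hχ.differentiableAt x)
        ((contDiff_inner_const l').differentiable (by simp) x), gradient_inner_const,
        (hχω x hxω).1, (hχω x hxω).2, one_smul, smul_zero, add_zero]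
    · rw [hx hxω, inner_zero_left, inner_zero_left]
  have z3 : ∫ x in ω, inner ℝ (g x) (R' x) = 0 := by
    rw [setIntegral_eq_integral_of_ae_compl_eq_zero
      (h.zero.mono fun x hx hxω => by rw [hx hxω, inner_zero_left])]
    obtain ⟨v, -, hv⟩ := h'.isWeakH1.exists_H10_mul_test isOpen_univ hχ
    rw [← integral_inner_grad_eq_zero h.memLp h.div_free v, ← setIntegral_univ]
    refine integral_congr_ae ?_
    filter_upwards [hv, ae_restrict_of_ae h.zero] with x h1 h2
    by_cases hxω : x ∈ ω
    · rw [h1, (hχω x hxω).1, (hχω x hxω).2, one_smul, smul_zero, zero_add]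
    · rw [h2 hxω, inner_zero_left, inner_zero_left]
  have i1 : Integrable (fun x => (inner ℝ m (R' x) : ℝ)) (vol ω) := iR.const_inner m
  have i2 : Integrable (fun x => (inner ℝ (g x) l' : ℝ)) (vol ω) := ig.inner_const l'
  have i3 : Integrable (fun x => (inner ℝ (g x) (R' x) : ℝ)) (vol ω) :=
    integrable_inner_of_memLp hgω hRω
  have i0 : Integrable (fun _ => (inner ℝ m l' : ℝ)) (vol ω) := integrable_const _
  have e : ∀ x, (inner ℝ (m + g x) (l' + R' x) : ℝ) =
      inner ℝ m l' + inner ℝ m (R' x) + (inner ℝ (g x) l' + inner ℝ (g x) (R' x)) := fun x => by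
    rw [inner_add_left, inner_add_right, inner_add_right]
  simp only [e]
  have i4 : Integrable (fun x => (inner ℝ m l' + inner ℝ m (R' x) : ℝ)) (vol ω) := i0.add i1
  have i5 : Integrable (fun x => (inner ℝ (g x) l' + inner ℝ (g x) (R' x) : ℝ)) (vol ω) :=
    i2.add i3
  rw [integral_add i4 i5, integral_add i0 i1, integral_add i2 i3, z2, z3, integral_inner iR, z1,
    inner_zero_right, setIntegral_const, smul_eq_mul]
  ring

/-- A matrix equivalent to a symmetric field on a nonempty open set is symmetric. -/
theorem IsCorrector.inner_comm {N : ℕ} {ω : Set (RN N)} (hω : IsOpen ω)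
    (hωb : Bornology.IsBounded ω) (hne : ω.Nonempty) {α β : ℝ} {A : RN N → Mat N}
    (hA : IsCoeff α β ω A) {M : Mat N} {l l' : RN N} {r r' : RN N → ℝ}
    {R g R' g' : RN N → RN N} (h : IsCorrector ω A M l r R g) (h' : IsCorrector ω A M l' r' R' g') :
    inner ℝ (Matrix.toEuclideanLin M l) l' = inner ℝ (Matrix.toEuclideanLin M l') l := by
  have hpos : 0 < volume.real ω :=
    ENNReal.toReal_pos (hω.measure_pos _ hne).ne' hωb.measure_lt_top.ne
  refine mul_left_cancel₀ hpos.ne' ?_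
  rw [← h.setIntegral_inner hωb h', ← h'.setIntegral_inner hωb h]
  refine integral_congr_ae ?_
  filter_upwards [hA.symm, ae_restrict_of_ae h.flux_eq, ae_restrict_of_ae h'.flux_eq,
    ae_restrict_mem hω.measurableSet] with x h1 h2 h3 hx
  rw [← h2 hx, ← h3 hx, inner_toEuclideanLin_comm h1, real_inner_comm]

/-- The quadratic form attains a positive minimum on the compact unit sphere, and homogeneity does
the rest. -/
theorem exists_coercive_of_posDef {N : ℕ} {M : Mat N}
    (hM : ∀ ξ : RN N, ξ ≠ 0 → 0 < inner ℝ (Matrix.toEuclideanLin M ξ) ξ) :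
    ∃ a : ℝ, 0 < a ∧ ∀ ξ : RN N, a * ‖ξ‖ ^ 2 ≤ inner ℝ (Matrix.toEuclideanLin M ξ) ξ := by
  have hmem : ∀ ξ : RN N, ξ ≠ 0 → ‖ξ‖⁻¹ • ξ ∈ Metric.sphere (0 : RN N) 1 := fun ξ hξ => by
    rw [mem_sphere_zero_iff_norm, norm_smul, norm_inv, norm_norm,
      inv_mul_cancel₀ (norm_ne_zero_iff.2 hξ)]
  have hcont : Continuous fun ξ : RN N => (inner ℝ (Matrix.toEuclideanLin M ξ) ξ : ℝ) :=
    (LinearMap.continuous_of_finiteDimensional _).inner continuous_id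
  suffices h : ∃ a : ℝ, 0 < a ∧ ∀ ξ ∈ Metric.sphere (0 : RN N) 1,
      a ≤ inner ℝ (Matrix.toEuclideanLin M ξ) ξ by
    obtain ⟨a, ha, h⟩ := h
    refine ⟨a, ha, fun ξ => ?_⟩
    rcases eq_or_ne ξ 0 with rfl | hξ
    · simp
    · have h1 := h _ (hmem ξ hξ)
      have hn : 0 < ‖ξ‖ := norm_pos_iff.2 hξ
      rw [map_smul, real_inner_smul_left, real_inner_smul_right] at h1
      calc a * ‖ξ‖ ^ 2 ≤ ‖ξ‖⁻¹ * (‖ξ‖⁻¹ * inner ℝ (Matrix.toEuclideanLin M ξ) ξ) * ‖ξ‖ ^ 2 := by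
            gcongr
        _ = _ := by field_simp
  rcases (Metric.sphere (0 : RN N) 1).eq_empty_or_nonempty with he | hne
  · exact ⟨1, one_pos, fun ξ hξ => absurd (he ▸ hξ) (notMem_empty _)⟩
  · obtain ⟨ξ, hξ, hmin⟩ := (isCompact_sphere (0 : RN N) 1).exists_isMinOn hne hcont.continuousOn
    exact ⟨_, hM ξ (Metric.ne_of_mem_sphere hξ one_ne_zero), fun η hη => hmin hη⟩

theorem isCoeff_const {N : ℕ} {M : Mat N} (hM : ∀ ξ : RN N, ξ ≠ 0 →
    0 < inner ℝ (Matrix.toEuclideanLin M ξ) ξ)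
    (hsymm : ∀ l l' : RN N,
      inner ℝ (Matrix.toEuclideanLin M l) l' = inner ℝ (Matrix.toEuclideanLin M l') l)
    (Ω : Set (RN N)) : ∃ a b : ℝ, 0 < a ∧ IsCoeff a b Ω fun _ => M := by
  obtain ⟨a, ha, h⟩ := exists_coercive_of_posDef hM
  refine ⟨a, ‖(Matrix.toEuclideanLin M).toContinuousLinearMap‖, ha, ⟨fun i j => aemeasurable_const,
    Eventually.of_forall fun _ i j => ?_, Eventually.of_forall fun _ => h,
    Eventually.of_forall fun _ ξ => (Matrix.toEuclideanLin M).toContinuousLinearMap.le_opNorm ξ⟩⟩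
  have := hsymm (EuclideanSpace.single j 1) (EuclideanSpace.single i 1)
  simpa [EuclideanSpace.inner_single_right, Matrix.toLpLin_apply] using this

/-- Serves the degenerate case of an empty `ω`, where symmetry of `M` cannot be read off from
correctors. -/
theorem isCoeff_of_eq_zero {N : ℕ} (α β : ℝ) {Ω : Set (RN N)} (hΩ : vol Ω = 0)
    (A : RN N → Mat N) : IsCoeff α β Ω A := by
  refine ⟨fun i j => ?_, ?_, ?_, ?_⟩ <;> rw [hΩ] <;> simp

/-! ### Passage to the limit. -/

/-- The oscillating fluxes are asymptotically `M∇u^n` in the sense of distributions. -/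
theorem tendsto_integral_flux_sub {N : ℕ} (hN : 1 ≤ N) {Ω : Set (RN N)} (hΩ : IsOpen Ω)
    (hΩb : Bornology.IsBounded Ω) {ω : Set (RN N)} (hω : IsOpen ω) (hωb : Bornology.IsBounded ω)
    (hne : ω.Nonempty) {α β : ℝ} (hα : 0 < α) {A : RN N → Mat N} {M : Mat N} {l : RN N}
    {r : RN N → ℝ} {R g : RN N → RN N} (h : IsCorrector ω A M l r R g) {K : ℕ → Type*}
    {ε : ∀ n, K n → ℝ} {y : ∀ n, K n → RN N} (hcov : IsVitaliCovering Ω ω ε y)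
    (hA : ∀ n, IsCoeff α β Ω (hsCoeff ω A (ε n) (y n))) {f : Lp ℝ 2 (vol Ω)} {u : ℕ → H10 Ω}
    (hu : ∀ n, IsDirichletSolution (hsCoeff ω A (ε n) (y n)) f (u n)) {φ : RN N → ℝ}
    (hφ : IsTest Ω φ) :
    Tendsto (fun n => ∫ x in Ω, φ x * (inner ℝ (flux (hsCoeff ω A (ε n) (y n)) (H10.grad (u n)) x) l -
        inner ℝ (Matrix.toEuclideanLin M l) (H10.grad (u n) x))) atTop (𝓝 0) := by
  obtain ⟨ρ, hρ0, hρ⟩ := hωb.exists_pos_norm_le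
  obtain ⟨ρ', hρ'⟩ := hΩb.exists_norm_le
  obtain ⟨L, hφL, hgL⟩ := hφ.exists_bound
  obtain ⟨c, hc, hcoer⟩ := IsCoeff.exists_coercive hN hΩb hα
  have hL : 0 ≤ L := (norm_nonneg _).trans (hgL 0)
  have hgb : ∀ n, ‖H10.grad (u n)‖ ≤ ‖f‖ / c := fun n =>
    (H10.norm_grad_le _).trans (norm_le_of_coercive hc (hA n) (hcoer (hA n)) (hu n))
  -- An infinite supremum becomes `0` here, which is harmless because the suprema are eventually at
  -- most `1`.
  let s : ℕ → ℝ := fun n => (⨆ p, ENNReal.ofReal (ε n p)).toReal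
  have hs : Tendsto s atTop (𝓝 0) := by
    have := (ENNReal.tendsto_toReal ENNReal.zero_ne_top).comp hcov.scales
    rwa [ENNReal.toReal_zero] at this
  let C : ℝ := ‖f‖ ^ 2 + (|β| * (‖f‖ / c)) ^ 2 + ρ * (‖f‖ / c) ^ 2 +
    ((∫ x, r x ^ 2) + ρ * ∫ x, ‖g x‖ ^ 2) / volume.real ω *
      volume.real (Metric.closedBall (0 : RN N) (ρ' + 2 * ρ))
  have hev : ∀ᶠ n in atTop, ⨆ p, ENNReal.ofReal (ε n p) ≤ 1 :=
    hcov.scales.eventually (Iic_mem_nhds one_pos)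
  refine squeeze_zero_norm' (a := fun n => L * s n * C) ?_ ?_
  · filter_upwards [hev] with n hn
    have := hcov.countable n
    have hfin : ⨆ p, ENNReal.ofReal (ε n p) ≠ ⊤ := (hn.trans_lt ENNReal.one_lt_top).ne
    have hsp : ∀ p, ε n p ≤ s n := fun p => by
      rw [← ENNReal.ofReal_le_iff_le_toReal hfin]
      exact le_iSup (fun p => ENNReal.ofReal (ε n p)) p
    have hs1 : s n ≤ 1 := ENNReal.toReal_le_of_le_ofReal zero_le_one (by simpa using hn)
    rw [Real.norm_eq_abs]
    refine (abs_integral_le_of_covering hΩ hω hne hρ hρ' h (hcov.pos n) (hcov.disjoint n)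
      (hcov.covers n) hsp ENNReal.toReal_nonneg hs1 (hA n) (hu n) hφ hφL hgL).trans ?_
    have hop : ‖(hA n).op (H10.grad (u n))‖ ≤ |β| * (‖f‖ / c) :=
      ((hA n).norm_op_le _).trans (mul_le_mul_of_nonneg_left (hgb n) (abs_nonneg _))
    have hg := hgb n
    have : 0 ≤ s n := ENNReal.toReal_nonneg
    refine mul_le_mul_of_nonneg_left ?_ (by positivity)
    simp only [C]
    gcongr
  · simpa using (hs.const_mul L).mul_const C

theorem mainTheorem1 {N : ℕ} (hN : 1 ≤ N)
    -- the domain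
    (Ω : Set (RN N)) (hΩ : IsOpen Ω) (hΩb : Bornology.IsBounded Ω)
    -- the basic cell and the coefficients on it
    (ω : Set (RN N)) (hω : IsOpen ω) (hωb : Bornology.IsBounded ω)
    (hω_null : volume (frontier ω) = 0)
    (α β : ℝ) (hα : 0 < α) (hαβ : α < β)
    (A : RN N → Mat N) (hA : IsCoeff α β ω A)
    -- the equivalent constant positive definite matrix
    (M : Mat N) (hM : ∀ ξ : RN N, ξ ≠ 0 → 0 < inner ℝ (Matrix.toEuclideanLin M ξ) ξ)
    (hAM : IsEquivalentTo ω A M)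
    -- the sequence of Vitali coverings
    {K : ℕ → Type*} (ε : ∀ n, K n → ℝ) (y : ∀ n, K n → RN N)
    (hcov : IsVitaliCovering Ω ω ε y)
    (f : Lp ℝ 2 (vol Ω)) :
    (∀ n, ∃! u : H10 Ω, IsDirichletSolution (hsCoeff ω A (ε n) (y n)) f u) ∧
    ∀ u : ℕ → H10 Ω, (∀ n, IsDirichletSolution (hsCoeff ω A (ε n) (y n)) f (u n)) →
      ∃ u₀ : H10 Ω,
        WeakTendsto u u₀ ∧
        (∃ (hσ : ∀ n, MemLp (flux (hsCoeff ω A (ε n) (y n)) (H10.grad (u n))) 2 (vol Ω))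
          (hσ₀ : MemLp (flux (fun _ => M) (H10.grad u₀)) 2 (vol Ω)),
          WeakTendsto (fun n => (hσ n).toLp _) (hσ₀.toLp _)) ∧
        IsDirichletSolution (fun _ => M) f u₀ := by
  have hB : ∀ n, IsCoeff α β Ω (hsCoeff ω A (ε n) (y n)) := fun n =>
    have := hcov.countable n
    isCoeff_hsCoeff hω hA (hcov.pos n) (hcov.disjoint n) (hcov.covers n)
  refine ⟨fun n => (hB n).existsUnique_isDirichletSolution hN hΩb hα f, fun u hu => ?_⟩
  choose r R g hcorr using hAM.exists_isCorrector hω hωb hω_null hA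
  rcases ω.eq_empty_or_nonempty with rfl | hne
  -- Empty cells can cover only a null set, so every integral over `Ω` vanishes.
  · have hΩ0 : vol Ω = 0 := by
      have := hcov.covers 0
      simp only [cell, image_empty, iUnion_empty, sdiff_empty] at this
      exact Measure.restrict_eq_zero.2 this
    refine weakTendsto_of_flux_sub_tendsto hN hΩ hΩb hα hα hB (isCoeff_of_eq_zero α β hΩ0 _) hu
      fun φ l _ => ?_
    simp only [hΩ0, integral_zero_measure, tendsto_const_nhds]
  · obtain ⟨a, b, ha, hMc⟩ := isCoeff_const hM
      (fun l l' => (hcorr l).inner_comm hω hωb hne hA (hcorr l')) Ω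
    exact weakTendsto_of_flux_sub_tendsto hN hΩ hΩb hα ha hB hMc hu fun φ l hφ =>
      tendsto_integral_flux_sub hN hΩ hΩb hω hωb hne hα (hcorr l) hcov hB hu hφ
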